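/- **Corollary (Confidence intervals).** Let $\mathcal X$ be a Polish space and let $(\Omega,\mathcal F,(\mathcal F_t)_{t\ge 0},X_t,P^x)$, $x\in\mathcal X$, be time-homogeneous càdlàg $\mathcal X$-valued Markov processes with $X_0=x$ under $P^x$ and $x\mapsto P^x$ measurable. For a probability measure $\mu$ on $\mathcal X$ write $P^\mu=\int P^x\,d\mu(x)$. Let $\mu^*$ be an ergodic invariant probability measure, let $\langle\cdot,\cdot\rangle$ and $\|\cdot\|$ be the scalar product and norm of the real Hilbert space $L^2(\mu^*)$, and let $(A,D(A))$ be the generator of the semigroup $\mathcal P_t g(x)=E^x[g(X_t)]$ on $L^2(\mu^*)$. Let $\langle\cdot,\cdot\rangle_\#$ be an inner product on $L^2(\mu^*)$, with norm $\|\cdot\|_\#$, such that 1. there are constants $0<c\le C<\infty$ with $c\|g\|\le\|g\|_\#\le C\|g\|$ for all $g\in L^2(\mu^*)$; 2. $\langle g,1\rangle_\#=\langle g,1\rangle$ for all $g\in L^2(\mu^*)$; 3. there is $\alpha>0$ with $\|g\|_\#^2\le\alpha\,\langle -Ag,g\rangle_\#$ for all $g\in D(A)$ with $\mu^*[g]=\int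 g\,d\mu^*=0$. Let $f:\mathcal X\to\mathbb R$ be bounded and measurable and not $\mu^*$-almost everywhere equal to a constant, put $\widehat f=f-\mu^*[f]$, let $M_{\pm\widehat f}$ be the operator of multiplication by $\pm\widehat f$ on $L^2(\mu^*)$, let $M_{\pm\widehat f}^\dagger$ be its adjoint with respect to $\langle\cdot,\cdot\rangle_\#$, and set $$v_\pm=2\alpha\left\|\tfrac12\big(M_{\pm\widehat f}+M_{\pm\widehat f}^\dagger\big)1\right\|_\#^2,\qquad b_\pm=\alpha\max\Big\{0,\sup_{\|g\|_\#=1}\langle M_{\pm\widehat f}\,g,g\rangle_\#\Big\}.$$ Let the initial distribution $\mu$ be a probability measure with $\mu\ll\mu^*$ and $\left\|\frac{d\mu}{d\mu^*}\right\|<\infty$, and put $N=c^{-1}\left\|\frac{d\mu}{d\mu^*}\right\|$. Then for every $T>0$ and every $\delta\in(0,1)$, $$P^\mu\left(\frac1T\int_0^T f(X_t)\,dt-\mu^*[f]\in(-r_-,r_+)\right)\ge 1-\delta,$$ where $$r_\pm=\sqrt{2v_\pm\,\frac1T\log\!\Big(\frac{2N}{\delta}\Big)}+b_\pm\,\frac1T\log\!\Big(\frac{2N}{\delta}\Big).$$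 -/

import Mathlib

open MeasureTheory ProbabilityTheory Filter Topology Set
open scoped NNReal ENNReal

noncomputable section

namespace ErgodicConfidence

section MarkovProcess

variable {𝓧 Ω : Type*} [TopologicalSpace 𝓧] [MeasurableSpace 𝓧] [mΩ : MeasurableSpace Ω]

/-- A path indexed by `[0, ∞)` is càdlàg: right-continuous with left limits. -/
def IsCadlag (w : ℝ≥0 → 𝓧) : Prop :=
  ∀ t : ℝ≥0, ContinuousWithinAt w (Ici t) t ∧ ∃ y : 𝓧, Tendsto w (𝓝[<] t) (𝓝 y)

/-- `(Ω, 𝓕, 𝓕ₜ, Xₜ, Pˣ)`, `x ∈ 𝓧`, is a family of time-homogeneous càdlàg Markov processes such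
that `X₀ = x` under `Pˣ`. The measurability of `x ↦ Pˣ` is part of `P` being a kernel. -/
structure IsMarkovFamily (ℱ : Filtration ℝ≥0 mΩ) (X : ℝ≥0 → Ω → 𝓧) (P : Kernel 𝓧 Ω) : Prop where
  isMarkovKernel : IsMarkovKernel P
  adapted : ∀ t, Measurable[ℱ t] (X t)
  cadlag : ∀ ω, IsCadlag (fun t => X t ω)
  initial : ∀ x, (P x).map (X 0) = Measure.dirac x
  /-- Markov property: `Pˣ(X_{s+t} ∈ B | 𝓕ₛ) = P^{Xₛ}(Xₜ ∈ B)`, almost surely under `Pˣ`. -/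
  markov : ∀ (x : 𝓧) (s t : ℝ≥0) (B : Set 𝓧), MeasurableSet B →
    (P x)⟦X (s + t) ⁻¹' B | ℱ s⟧ =ᵐ[P x] fun ω => (P (X s ω)).real (X t ⁻¹' B)

/-- `P^μ = ∫ Pˣ dμ(x)`, the law of the process with initial distribution `μ`. -/
def lawFrom (P : Kernel 𝓧 Ω) (μ : Measure 𝓧) : Measure Ω := μ.bind P

/-- `μs` is invariant: if `X₀` has law `μs` then so does every `Xₜ`. -/
def IsInvariant (X : ℝ≥0 → Ω → 𝓧) (P : Kernel 𝓧 Ω) (μs : Measure 𝓧) : Prop :=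
  ∀ t, (lawFrom P μs).map (X t) = μs

/-- Ergodicity of an invariant probability measure `μs`: every measurable set `B` with
`Pˣ(Xₜ ∈ B) = 1_B(x)` for `μs`-almost every `x`, for every `t`, has measure `0` or `1`. -/
def IsErgodic (X : ℝ≥0 → Ω → 𝓧) (P : Kernel 𝓧 Ω) (μs : Measure 𝓧) : Prop :=
  ∀ B : Set 𝓧, MeasurableSet B →
    (∀ t, (fun x => (P x).real (X t ⁻¹' B)) =ᵐ[μs] B.indicator (fun _ => (1 : ℝ))) →
    μs B = 0 ∨ μs B = 1

/-- The transition operators `(𝒫ₜ g)(x) = Eˣ[g(Xₜ)]`. -/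
def transition (X : ℝ≥0 → Ω → 𝓧) (P : Kernel 𝓧 Ω) (t : ℝ≥0) (g : 𝓧 → ℝ) (x : 𝓧) : ℝ :=
  ∫ ω, g (X t ω) ∂(P x)

/-- The generator `(A, D(A))` of the semigroup `𝒫ₜ` on `L²(μs)`, given by its graph:
`g ∈ D(A)` and `A g = h` if and only if `(𝒫ₜ g - g) / t → h` in `L²(μs)` as `t ↓ 0`. -/
def GeneratorGraph (X : ℝ≥0 → Ω → 𝓧) (P : Kernel 𝓧 Ω) (μs : Measure 𝓧)
    (g h : Lp ℝ 2 μs) : Prop :=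
  Tendsto (fun t : ℝ≥0 =>
      eLpNorm (fun x => (transition X P t g x - g x) / (t : ℝ) - h x) 2 μs)
    (𝓝[>] 0) (𝓝 0)

/-- The ergodic average `(1 / T) ∫₀ᵀ f(Xₜ) dt`. -/
def ergodicAverage (X : ℝ≥0 → Ω → 𝓧) (f : 𝓧 → ℝ) (T : ℝ) (ω : Ω) : ℝ :=
  (1 / T) * ∫ t in (0 : ℝ)..T, f (X t.toNNReal ω)

end MarkovProcess

section ModifiedInnerProduct

variable {𝓧 : Type*} [MeasurableSpace 𝓧]

/-- `f - μs[f]`, for a bounded measurable `f`, as an element of `L^∞(μs)`. -/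
def centered (μs : Measure 𝓧) [IsProbabilityMeasure μs] {f : 𝓧 → ℝ} (hf : Measurable f)
    (hb : ∃ K, ∀ x, |f x| ≤ K) : Lp ℝ ∞ μs :=
  MemLp.toLp (fun x => f x - ∫ y, f y ∂μs)
    ((memLp_top_of_bound hf.aestronglyMeasurable hb.choose
      (Eventually.of_forall hb.choose_spec)).sub (memLp_const _))

variable {μs : Measure 𝓧}

/-- The multiplication operator `M_φ : g ↦ φ g` on `L²(μs)`, for `φ ∈ L^∞(μs)`. -/
def mulOp (φ : Lp ℝ ∞ μs) : Lp ℝ 2 μs →L[ℝ] Lp ℝ 2 μs :=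
  (ContinuousLinearMap.mul ℝ ℝ).holderL μs ∞ 2 2 φ

/-- The bilinear form `B` is an inner product: symmetric and positive definite. -/
structure IsInnerProduct (B : LinearMap.BilinForm ℝ (Lp ℝ 2 μs)) : Prop where
  symm : ∀ g h, B g h = B h g
  pos : ∀ g, g ≠ 0 → 0 < B g g

/-- The norm `‖g‖_# = √⟨g, g⟩_#` of an inner product `⟨·,·⟩_# = B`. -/
def sharpNorm (B : LinearMap.BilinForm ℝ (Lp ℝ 2 μs)) (g : Lp ℝ 2 μs) : ℝ :=
  √(B g g)

/-- `N` is the adjoint of `M` with respect to `B`. -/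
def IsSharpAdjoint (B : LinearMap.BilinForm ℝ (Lp ℝ 2 μs))
    (M N : Lp ℝ 2 μs →L[ℝ] Lp ℝ 2 μs) : Prop :=
  ∀ g h, B (M g) h = B g (N h)

open Classical in
/-- The adjoint `M†` of a bounded operator `M` with respect to `B`. It exists and is unique when
`B` is an inner product whose norm is equivalent to that of `L²(μs)`: see `sharpAdjoint_spec` and
`sharpAdjoint_unique`. -/
def sharpAdjoint (B : LinearMap.BilinForm ℝ (Lp ℝ 2 μs)) (M : Lp ℝ 2 μs →L[ℝ] Lp ℝ 2 μs) :
    Lp ℝ 2 μs →L[ℝ] Lp ℝ 2 μs :=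
  if h : ∃ N, IsSharpAdjoint B M N then h.choose else 0

theorem sharpAdjoint_spec {B : LinearMap.BilinForm ℝ (Lp ℝ 2 μs)} (hB : IsInnerProduct B)
    {c C : ℝ} (hc : 0 < c) (hlow : ∀ g, c * ‖g‖ ≤ sharpNorm B g)
    (hup : ∀ g, sharpNorm B g ≤ C * ‖g‖) (M : Lp ℝ 2 μs →L[ℝ] Lp ℝ 2 μs) :
    IsSharpAdjoint B M (sharpAdjoint B M) := by
  have hnn : ∀ g, 0 ≤ B g g := fun g => by
    rcases eq_or_ne g 0 with rfl | h
    · simp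
    · exact (hB.pos g h).le
  have hbd : ∀ g h, ‖B g h‖ ≤ (C * C) * ‖g‖ * ‖h‖ := fun g h => by
    have h1 : (B g h) ^ 2 ≤ B g g * B h h :=
      LinearMap.BilinForm.apply_sq_le_of_symm B hnn ⟨fun x y => by simpa using hB.symm x y⟩ g h
    have h2 : |B g h| ≤ sharpNorm B g * sharpNorm B h := by
      rw [sharpNorm, sharpNorm, ← Real.sqrt_mul (hnn g), ← Real.sqrt_sq_eq_abs]
      exact Real.sqrt_le_sqrt h1
    calc ‖B g h‖ ≤ sharpNorm B g * sharpNorm B h := h2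
      _ ≤ (C * ‖g‖) * (C * ‖h‖) :=
        mul_le_mul (hup g) (hup h) (Real.sqrt_nonneg _) ((Real.sqrt_nonneg _).trans (hup g))
      _ = (C * C) * ‖g‖ * ‖h‖ := by ring
  let Bc : Lp ℝ 2 μs →L[ℝ] Lp ℝ 2 μs →L[ℝ] ℝ := LinearMap.mkContinuous₂ B (C * C) hbd
  have hBc : ∀ g h, Bc g h = B g h := fun g h => rfl
  have hco : IsCoercive Bc := by
    refine ⟨c * c, mul_pos hc hc, fun u => ?_⟩
    have h0 : 0 ≤ c * ‖u‖ := by positivity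
    have h1 := mul_self_le_mul_self h0 (hlow u)
    rw [sharpNorm, Real.mul_self_sqrt (hnn u)] at h1
    rw [hBc]
    linarith
  let G := hco.continuousLinearEquivOfBilin
  have hG : ∀ v w, inner ℝ (G v) w = B v w :=
    fun v w => hco.continuousLinearEquivOfBilin_apply v w
  have hex : ∃ N, IsSharpAdjoint B M N := by
    refine ⟨(G.symm : Lp ℝ 2 μs →L[ℝ] Lp ℝ 2 μs) ∘L
      (ContinuousLinearMap.adjoint M ∘L (G : Lp ℝ 2 μs →L[ℝ] Lp ℝ 2 μs)), fun g h => ?_⟩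
    rw [hB.symm, ← hG h (M g), hB.symm g, ← hG]
    simp [ContinuousLinearMap.adjoint_inner_left]
  rw [sharpAdjoint, dif_pos hex]
  exact hex.choose_spec

theorem sharpAdjoint_unique {B : LinearMap.BilinForm ℝ (Lp ℝ 2 μs)} (hB : IsInnerProduct B)
    {M N₁ N₂ : Lp ℝ 2 μs →L[ℝ] Lp ℝ 2 μs} (h₁ : IsSharpAdjoint B M N₁)
    (h₂ : IsSharpAdjoint B M N₂) : N₁ = N₂ := by
  ext1 h
  by_contra hne
  have h3 := hB.pos (N₁ h - N₂ h) (sub_ne_zero.mpr hne)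
  rw [map_sub, ← h₁, ← h₂, sub_self] at h3
  exact lt_irrefl _ h3

/-- `2 α ‖½ (M_φ + M_φ†) 1‖_#²`. -/
def vConst [IsFiniteMeasure μs] (B : LinearMap.BilinForm ℝ (Lp ℝ 2 μs)) (α : ℝ)
    (φ : Lp ℝ ∞ μs) : ℝ :=
  2 * α * sharpNorm B
    ((1 / 2 : ℝ) • (mulOp φ + sharpAdjoint B (mulOp φ)) (Lp.const 2 μs (1 : ℝ))) ^ 2

/-- `α max {0, sup_{‖g‖_# = 1} ⟨M_φ g, g⟩_#}`. -/
def bConst (B : LinearMap.BilinForm ℝ (Lp ℝ 2 μs)) (α : ℝ) (φ : Lp ℝ ∞ μs) : ℝ :=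
  α * max 0 (sSup {s : ℝ | ∃ g : Lp ℝ 2 μs, sharpNorm B g = 1 ∧ s = B (mulOp φ g) g})

/-- The `L²(μs)`-norm of the density `dμ/dμs`. -/
def densityNorm (μ μs : Measure 𝓧) : ℝ :=
  (eLpNorm (fun x => (μ.rnDeriv μs x).toReal) 2 μs).toReal

/-- `√(2 v η) + b η` with `η = log(2 N / δ) / T`. -/
def radius (v b N δ T : ℝ) : ℝ :=
  √(2 * v * (1 / T) * Real.log (2 * N / δ)) + b * (1 / T) * Real.log (2 * N / δ)

end ModifiedInnerProduct

end ErgodicConfidence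

end

open ErgodicConfidence

/-! Each tail is bounded by Chernoff's method. For a centred bounded `V` and `lam ≥ 0`, let `u_t(x)
= E^x[exp(lam ∫₀ᵗ V(X_s) ds)]`. Since `μ ≪ μs`, the exponential moment under `P^μ` is `⟨dμ/dμs, u_T⟩
≤ ‖dμ/dμs‖ ‖u_T‖`, so it suffices to bound the growth of `u_t` in `L²(μs)`, at the cost of a factor
`c⁻¹` for working in the modified norm.

The curve `u_t` solves `u' = A u + lam V u` with `u_0 = 1`. This is shown directly from the Markov
property: `𝒫_r u_t` is the same exponential functional over the shifted window `[r, r + t]`, so both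
the right derivative of `u_t` and membership in `D(A)` come from differentiating exponentials of
path integrals (`hasDerivWithinAt_feynmanKacLp`, `generatorGraph_feynmanKacLp`). No perturbation
theory of semigroups is needed.

For the energy estimate, write `g = h + a` with `a` the mean of `g`. Invariance and `⟨·, 1⟩_# = ⟨·,
1⟩` make `⟨Ag, 1⟩_#` vanish, so the Poincaré inequality gives `⟨Ag, g⟩_# ≤ -‖h‖_#² / α`. As `V` is
centred, `⟨Vg, g⟩_#` has no `a²` term; its cross term involves `½ (M + M†) 1`. Completing the square
gives `⟨(A + lam V) g, g⟩_# ≤ Λ ‖g‖_#²` with `Λ = lam² v / (2 (1 - lam b))`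
(`form_generator_add_mulOp_le`), hence `‖u_T‖_# ≤ exp(T Λ)` by Grönwall.

This is a sub-gamma bound. Optimising over `lam` gives tail probability `δ / 2` at the stated radius
(`le_mul_exp_of_subgamma`), and the union of the tails for `V` and `-V` costs `δ`. -/

namespace ErgodicConfidence

/-! ### Grid approximation and joint measurability of càdlàg processes. -/

section RightContinuousPaths

/-- The first point of the grid `ε ℤ` strictly to the right of `s`. -/
noncomputable def nextGrid (ε s : ℝ) : ℝ := ε * (⌊s / ε⌋ + 1)

theorem lt_nextGrid {ε : ℝ} (hε : 0 < ε) (s : ℝ) : s < nextGrid ε s := by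
  have h := Int.lt_floor_add_one (s / ε)
  rw [div_lt_iff₀ hε] at h
  rw [nextGrid]; linarith

theorem nextGrid_le {ε : ℝ} (hε : 0 < ε) (s : ℝ) : nextGrid ε s ≤ s + ε := by
  have h := Int.floor_le (s / ε)
  rw [le_div_iff₀ hε] at h
  rw [nextGrid]; linarith

theorem measurable_nextGrid (ε : ℝ) : Measurable (nextGrid ε) := by
  unfold nextGrid
  have : Measurable fun s : ℝ => ((⌊s / ε⌋ : ℤ) : ℝ) :=
    (measurable_from_top (f := fun n : ℤ => (n : ℝ))).comp
      (Int.measurable_floor.comp (measurable_id.div_const ε))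
  exact (this.add_const 1).const_mul ε

theorem tendsto_nextGrid {ε : ℕ → ℝ} (hε : ∀ n, 0 < ε n) (h0 : Tendsto ε atTop (𝓝 0)) (s : ℝ) :
    Tendsto (fun n => nextGrid (ε n) s) atTop (𝓝[≥] s) := by
  refine tendsto_nhdsWithin_iff.2 ⟨?_, Eventually.of_forall fun n => (lt_nextGrid (hε n) s).le⟩
  refine tendsto_of_tendsto_of_tendsto_of_le_of_le tendsto_const_nhds
    (h := fun n => s + ε n) (by simpa using tendsto_const_nhds.add h0)
    (fun n => (lt_nextGrid (hε n) s).le) (fun n => nextGrid_le (hε n) s)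

theorem tendsto_one_div_succ : Tendsto (fun n : ℕ => 1 / ((n : ℝ) + 1)) atTop (𝓝 0) :=
  tendsto_one_div_add_atTop_nhds_zero_nat

theorem IsCadlag.tendsto_toNNReal {𝓧 : Type*} [TopologicalSpace 𝓧] {w : ℝ≥0 → 𝓧} (hw : IsCadlag w) (s : ℝ) :
    Tendsto (fun r : ℝ => w r.toNNReal) (𝓝[≥] s) (𝓝 (w s.toNNReal)) := by
  have h1 := (hw s.toNNReal).1
  refine h1.tendsto.comp (tendsto_nhdsWithin_iff.2 ⟨?_, ?_⟩)
  · exact (continuous_real_toNNReal.tendsto s).mono_left nhdsWithin_le_nhds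
  · filter_upwards [self_mem_nhdsWithin] with r hr
    exact Real.toNNReal_le_toNNReal hr

/-- By right-continuity the process is the pointwise limit of its values at the next grid point.
Each approximation depends on time only through an integer, so countability of `ℤ` gives joint
measurability. -/
theorem measurable_uncurry_of_isCadlag {𝓧 Ω : Type*} [TopologicalSpace 𝓧] [PolishSpace 𝓧]
    [MeasurableSpace 𝓧] [BorelSpace 𝓧] [MeasurableSpace Ω] {X : ℝ≥0 → Ω → 𝓧} (hm : ∀ t, Measurable (X t))
    (hc : ∀ ω, IsCadlag fun t => X t ω) :
    Measurable fun p : ℝ × Ω => X p.1.toNNReal p.2 := by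
  let _ := TopologicalSpace.upgradeIsCompletelyMetrizable 𝓧
  refine measurable_of_tendsto_metrizable
    (f := fun (n : ℕ) (p : ℝ × Ω) => X (nextGrid (1 / ((n : ℝ) + 1)) p.1).toNNReal p.2)
    (fun n => ?_) ?_
  · have h1 : Measurable fun q : ℤ × Ω => X (1 / ((n : ℝ) + 1) * (q.1 + 1)).toNNReal q.2 :=
      measurable_from_prod_countable_right fun k =>
        hm (1 / ((n : ℝ) + 1) * (k + 1)).toNNReal
    exact h1.comp ((Int.measurable_floor.comp (measurable_fst.div_const _)).prodMk measurable_snd)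
  · rw [tendsto_pi_nhds]
    rintro ⟨s, ω⟩
    exact ((hc ω).tendsto_toNNReal s).comp
      (tendsto_nextGrid (fun n => by positivity) tendsto_one_div_succ s)

end RightContinuousPaths

/-! ### Averages and Riemann sums of processes right-continuous in `L¹`. -/

section L1RightContinuous

variable {Ω : Type*} [MeasurableSpace Ω]

/-- A bounded, jointly measurable real process that is right-continuous in `L¹`. -/
structure IsL1RightCts (Q : Measure Ω) (v : ℝ → Ω → ℝ) (K : ℝ) : Prop where
  measurable : Measurable (Function.uncurry v)
  bound : ∀ s ω, |v s ω| ≤ K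
  tendsto : ∀ t, Tendsto (fun s => ∫ ω, |v s ω - v t ω| ∂Q) (𝓝[≥] t) (𝓝 0)

theorem integrable_of_abs_le {Q : Measure Ω} [IsFiniteMeasure Q] {f : Ω → ℝ} {K : ℝ}
    (hf : Measurable f) (hK : ∀ ω, |f ω| ≤ K) : Integrable f Q :=
  Integrable.of_bound hf.aestronglyMeasurable K (Eventually.of_forall hK)

theorem integral_abs_intervalIntegral_le {Q : Measure Ω} [IsFiniteMeasure Q] {F : ℝ → Ω → ℝ}
    {K : ℝ} (hF : Measurable (Function.uncurry F)) (hK : ∀ s ω, |F s ω| ≤ K) {a b : ℝ}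
    (hab : a ≤ b) :
    ∫ ω, |∫ s in a..b, F s ω| ∂Q ≤ ∫ s in a..b, ∫ ω, |F s ω| ∂Q := by
  simp only [intervalIntegral.integral_of_le hab]
  have hint : Integrable (fun p : Ω × ℝ => |F p.2 p.1|)
      (Q.prod (volume.restrict (Ioc a b))) :=
    integrable_of_abs_le (K := K) (hF.comp measurable_swap).abs fun p => by
      rw [abs_abs]; exact hK _ _
  rw [← integral_integral_swap (f := fun ω s => |F s ω|) hint]
  refine integral_mono_of_nonneg (Eventually.of_forall fun _ => abs_nonneg _)
    hint.integral_prod_left (Eventually.of_forall fun ω => abs_integral_le_integral_abs)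

namespace IsL1RightCts

variable {Q : Measure Ω} {v : ℝ → Ω → ℝ} {K : ℝ}

theorem measurable_apply (h : IsL1RightCts Q v K) (s : ℝ) : Measurable (v s) :=
  h.measurable.comp (measurable_const.prodMk measurable_id)

theorem measurable_left (h : IsL1RightCts Q v K) (ω : Ω) : Measurable fun s => v s ω :=
  h.measurable.comp (measurable_id.prodMk measurable_const)

theorem intervalIntegrable (h : IsL1RightCts Q v K) (ω : Ω) (a b : ℝ) :
    IntervalIntegrable (fun s => v s ω) volume a b := by
  refine (intervalIntegrable_const (c := K)).mono_fun (h.measurable_left ω).aestronglyMeasurable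
    (Eventually.of_forall fun s => ?_)
  exact (h.bound s ω).trans (le_abs_self K)

theorem measurable_intervalIntegral (h : IsL1RightCts Q v K) (a b : ℝ) :
    Measurable fun ω => ∫ s in a..b, v s ω := by
  have h1 : StronglyMeasurable (Function.uncurry fun ω s => v s ω) :=
    (h.measurable.comp measurable_swap).stronglyMeasurable
  simp only [intervalIntegral]
  exact (h1.integral_prod_right.sub h1.integral_prod_right).measurable

theorem abs_intervalIntegral_le (h : IsL1RightCts Q v K) (ω : Ω) (a b : ℝ) :
    |∫ s in a..b, v s ω| ≤ K * |b - a| := by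
  simpa using intervalIntegral.norm_integral_le_of_norm_le_const
    (f := fun s => v s ω) (a := a) (b := b) fun s _ => h.bound s ω

theorem shift (h : IsL1RightCts Q v K) (a : ℝ) : IsL1RightCts Q (fun s => v (a + s)) K where
  measurable := h.measurable.comp ((measurable_fst.const_add a).prodMk measurable_snd)
  bound s ω := h.bound _ ω
  tendsto t := by
    refine (h.tendsto (a + t)).comp (tendsto_nhdsWithin_iff.2 ⟨?_, ?_⟩)
    · exact ((continuous_const.add continuous_id).tendsto t).mono_left nhdsWithin_le_nhds
    · filter_upwards [self_mem_nhdsWithin] with r hr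
      exact add_le_add_right hr a

/-- Lebesgue differentiation at every time rather than almost every time: the `L¹` distance to `v t`
is small throughout a right neighbourhood of `t`, and Fubini passes this to the average. -/
theorem tendsto_average [IsFiniteMeasure Q] (h : IsL1RightCts Q v K) (t : ℝ) :
    Tendsto (fun r : ℝ => ∫ ω, |(∫ s in t..t + r, v s ω) / r - v t ω| ∂Q) (𝓝[>] 0) (𝓝 0) := by
  rw [Metric.tendsto_nhds]
  intro ε hε
  obtain ⟨u, hu, hu'⟩ := (mem_nhdsGE_iff_exists_Ico_subset).1
    ((h.tendsto t).eventually (gt_mem_nhds (half_pos hε)))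
  have hu0 : 0 < u - t := sub_pos.2 hu
  filter_upwards [Ioo_mem_nhdsGT hu0] with r hr
  have hmeas : Measurable (Function.uncurry fun s ω => v s ω - v t ω) :=
    h.measurable.sub ((h.measurable_apply t).comp measurable_snd)
  have hbd : ∀ s ω, |v s ω - v t ω| ≤ K + K := fun s ω =>
    (abs_sub _ _).trans (add_le_add (h.bound _ _) (h.bound _ _))
  have e1 : ∀ ω, |(∫ s in t..t + r, v s ω) / r - v t ω|
      = r⁻¹ * |∫ s in t..t + r, (v s ω - v t ω)| := fun ω => by
    rw [intervalIntegral.integral_sub (h.intervalIntegrable ω _ _) intervalIntegrable_const,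
      intervalIntegral.integral_const, add_sub_cancel_left, smul_eq_mul,
      ← abs_of_pos (inv_pos.2 hr.1), ← abs_mul]
    congr 1
    field_simp [hr.1.ne']
  have h2 : ∫ s in t..t + r, ∫ ω, |v s ω - v t ω| ∂Q ≤ ∫ s in t..t + r, ε / 2 := by
    rw [intervalIntegral.integral_of_le (by linarith [hr.1]),
      intervalIntegral.integral_of_le (by linarith [hr.1])]
    refine integral_mono_of_nonneg (Eventually.of_forall fun s => integral_nonneg fun _ =>
      abs_nonneg _) (integrable_const _) ?_
    refine (ae_restrict_iff' measurableSet_Ioc).2 (Eventually.of_forall fun s hs => ?_)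
    exact (hu' ⟨hs.1.le, by linarith [hs.2, hr.2]⟩).le
  have h1 := integral_abs_intervalIntegral_le (Q := Q) hmeas hbd (by linarith [hr.1] : t ≤ t + r)
  rw [intervalIntegral.integral_const, add_sub_cancel_left, smul_eq_mul] at h2
  rw [dist_zero_right, Real.norm_of_nonneg (integral_nonneg fun _ => abs_nonneg _)]
  simp_rw [e1]
  rw [integral_const_mul]
  calc _ ≤ r⁻¹ * (r * (ε / 2)) := by
        have := inv_pos.2 hr.1
        gcongr
        exact h1.trans h2
    _ = ε / 2 := by field_simp [hr.1.ne']
    _ < ε := half_lt_self hε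

/-- On each cell `nextGrid` is constant, equal to the right endpoint. It jumps at that endpoint
itself, which is discarded as a null set. -/
theorem intervalIntegral_nextGrid {ε : ℝ} (hε : 0 < ε) (w : ℝ → ℝ) (n : ℕ) :
    IntervalIntegrable (fun s => w (nextGrid ε s)) volume 0 (n * ε) ∧
    ∫ s in 0..n * ε, w (nextGrid ε s) = ∑ j ∈ Finset.range n, ε * w ((j + 1) * ε) := by
  have key : ∀ j : ℕ, EqOn (fun s => w (nextGrid ε s)) (fun _ => w ((j + 1) * ε))
      (Ioo (j * ε) ((j + 1) * ε)) := fun j s hs => by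
    have : ⌊s / ε⌋ = j := by
      rw [Int.floor_eq_iff]
      exact ⟨by rw [le_div_iff₀ hε]; exact_mod_cast hs.1.le,
        by rw [div_lt_iff₀ hε]; exact_mod_cast hs.2⟩
    simp [nextGrid, this, mul_comm]
  have hii : ∀ j : ℕ, IntervalIntegrable (fun s => w (nextGrid ε s)) volume (j * ε)
      (((j + 1 : ℕ) : ℝ) * ε) := fun j => by
    refine (intervalIntegrable_const (c := w ((j + 1) * ε))).congr_ae ?_
    rw [uIoc_of_le (by push_cast; nlinarith), Filter.EventuallyEq,
      ae_restrict_iff' measurableSet_Ioc]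
    have : ∀ᵐ s : ℝ, s ≠ (j + 1) * ε := by simp [ae_iff]
    filter_upwards [this] with s hs hs2
    push_cast at hs2
    exact (key j ⟨hs2.1, lt_of_le_of_ne hs2.2 hs⟩).symm
  refine ⟨?_, ?_⟩
  · simpa using IntervalIntegrable.trans_iterate (a := fun j : ℕ => (j : ℝ) * ε)
      (n := n) fun k _ => hii k
  have h1 := intervalIntegral.sum_integral_adjacent_intervals (a := fun j : ℕ => (j : ℝ) * ε)
    (n := n) fun k _ => hii k
  simp only [Nat.cast_zero, zero_mul] at h1
  rw [← h1]
  refine Finset.sum_congr rfl fun j _ => ?_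
  have : ∫ s in (j * ε : ℝ)..((j + 1 : ℕ) : ℝ) * ε, w (nextGrid ε s)
      = ∫ s in (j * ε : ℝ)..((j + 1 : ℕ) : ℝ) * ε, w ((j + 1) * ε) := by
    refine intervalIntegral.integral_congr_ae ?_
    have : ∀ᵐ s : ℝ, s ≠ (j + 1) * ε := by simp [ae_iff]
    filter_upwards [this] with s hs hs2
    rw [uIoc_of_le (by push_cast; nlinarith)] at hs2
    push_cast at hs2
    exact key j ⟨hs2.1, lt_of_le_of_ne hs2.2 hs⟩
  rw [this, intervalIntegral.integral_const]
  push_cast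
  rw [smul_eq_mul]; ring

/-- The Riemann sum is the integral of the process sampled at `nextGrid`. Grid points approach `s`
from the right, so right-continuity in `L¹` and dominated convergence in `s` suffice. -/
theorem tendsto_riemannSum [IsFiniteMeasure Q] (h : IsL1RightCts Q v K) {t : ℝ} (ht : 0 < t) :
    Tendsto (fun n : ℕ => ∫ ω, |∑ j ∈ Finset.range (n + 1),
        t / ((n : ℝ) + 1) * v ((j + 1) * (t / ((n : ℝ) + 1))) ω - ∫ s in 0..t, v s ω| ∂Q)
      atTop (𝓝 0) := by
  set ε : ℕ → ℝ := fun n => t / ((n : ℝ) + 1) with hεd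
  have hε : ∀ n, 0 < ε n := fun n => by positivity
  have hε0 : Tendsto ε atTop (𝓝 0) := by
    have := tendsto_one_div_succ.const_mul t
    simpa [hεd, div_eq_mul_inv] using this
  have hn : ∀ n : ℕ, ((n + 1 : ℕ) : ℝ) * ε n = t := fun n => by
    simp only [hεd]; push_cast; field_simp
  have hF : ∀ n, Measurable (Function.uncurry fun s ω => v (nextGrid (ε n) s) ω - v s ω) :=
    fun n => (h.measurable.comp
      (((measurable_nextGrid _).comp measurable_fst).prodMk measurable_snd)).sub h.measurable
  have hK : ∀ n s ω, |v (nextGrid (ε n) s) ω - v s ω| ≤ K + K := fun n s ω =>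
    (abs_sub _ _).trans (add_le_add (h.bound _ _) (h.bound _ _))
  have hlim : Tendsto (fun n => ∫ s in 0..t, ∫ ω, |v (nextGrid (ε n) s) ω - v s ω| ∂Q) atTop
      (𝓝 (∫ s in 0..t, (0 : ℝ))) := by
    refine intervalIntegral.tendsto_integral_filter_of_dominated_convergence
      (fun _ => Q.real univ * (K + K)) (Eventually.of_forall fun n => ?_)
      (Eventually.of_forall fun n => Eventually.of_forall fun s _ => ?_)
      intervalIntegrable_const (Eventually.of_forall fun s _ => ?_)
    · exact ((hF n).abs.stronglyMeasurable.integral_prod_right').aestronglyMeasurable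
    · rw [Real.norm_of_nonneg (integral_nonneg fun _ => abs_nonneg _)]
      refine (integral_mono_of_nonneg (Eventually.of_forall fun _ => abs_nonneg _)
        (integrable_const (K + K)) (Eventually.of_forall fun ω => hK n s ω)).trans (by simp)
    · exact (h.tendsto s).comp (tendsto_nextGrid hε hε0 s)
  rw [intervalIntegral.integral_zero] at hlim
  refine squeeze_zero (fun n => integral_nonneg fun _ => abs_nonneg _) (fun n => ?_) hlim
  refine le_trans (le_of_eq ?_) (integral_abs_intervalIntegral_le (Q := Q) (hF n) (hK n) ht.le)
  refine integral_congr_ae (Eventually.of_forall fun ω => ?_)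
  have h1 := intervalIntegral_nextGrid (hε n) (fun s => v s ω) (n + 1)
  rw [hn n] at h1
  simp only
  rw [intervalIntegral.integral_sub h1.1 (h.intervalIntegrable ω _ _), h1.2]

end IsL1RightCts

end L1RightContinuous

/-! ### Integration under the law with a given initial distribution. -/

section Law

variable {𝓧 Ω : Type*} [MeasurableSpace 𝓧] [mΩ : MeasurableSpace Ω] {P : Kernel 𝓧 Ω}
  {μ : Measure 𝓧}

instance isProbabilityMeasure_lawFrom [IsMarkovKernel P] [IsProbabilityMeasure μ] : IsProbabilityMeasure (lawFrom P μ) := by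
  unfold lawFrom; infer_instance

theorem integral_lawFrom {Y : Ω → ℝ} (hY : Integrable Y (lawFrom P μ)) :
    ∫ ω, Y ω ∂(lawFrom P μ) = ∫ x, ∫ ω, Y ω ∂(P x) ∂μ := by
  have h : lawFrom P μ = (P ∘ₖ Kernel.const Unit μ) () := by
    rw [Kernel.comp_apply, Kernel.const_apply]; rfl
  rw [h] at hY ⊢
  rw [Kernel.integral_comp hY, Kernel.const_apply]

theorem measurable_integral_kernel [IsSFiniteKernel P] {Y : Ω → ℝ} (hY : Measurable Y) :
    Measurable fun x => ∫ ω, Y ω ∂(P x) :=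
  (hY.stronglyMeasurable.integral_kernel (κ := P)).measurable

theorem abs_integral_kernel_le [IsMarkovKernel P] {Y : Ω → ℝ} {K : ℝ} (hK : ∀ ω, |Y ω| ≤ K) (x : 𝓧) :
    |∫ ω, Y ω ∂(P x)| ≤ K := by
  simpa using norm_integral_le_of_norm_le_const (μ := P x) (f := Y) (Eventually.of_forall hK)

/-- Conditioning on the starting point contracts `L¹` distances. -/
theorem integral_abs_integral_sub_le [IsMarkovKernel P] [IsProbabilityMeasure μ] {Y Y' : Ω → ℝ} {K K' : ℝ} (hY : Measurable Y)
    (hY' : Measurable Y') (hK : ∀ ω, |Y ω| ≤ K) (hK' : ∀ ω, |Y' ω| ≤ K') :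
    ∫ x, |∫ ω, Y ω ∂(P x) - ∫ ω, Y' ω ∂(P x)| ∂μ ≤ ∫ ω, |Y ω - Y' ω| ∂(lawFrom P μ) := by
  have hd : ∀ ω, |(|Y ω - Y' ω|)| ≤ K + K' := fun ω => by
    rw [abs_abs]; exact (abs_sub _ _).trans (add_le_add (hK ω) (hK' ω))
  rw [integral_lawFrom (Y := fun ω => |Y ω - Y' ω|) (integrable_of_abs_le (hY.sub hY').abs hd)]
  refine integral_mono_of_nonneg (Eventually.of_forall fun _ => abs_nonneg _)
    (integrable_of_abs_le (measurable_integral_kernel (hY.sub hY').abs)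
      fun x => abs_integral_kernel_le hd x) (Eventually.of_forall fun x => ?_)
  simp only
  rw [← integral_sub (integrable_of_abs_le hY hK) (integrable_of_abs_le hY' hK')]
  exact abs_integral_le_integral_abs

end Law

/-! ### Integrated forms of the Markov property and continuity in `L¹`. -/

section Markov

variable {𝓧 Ω : Type*} [TopologicalSpace 𝓧] [MeasurableSpace 𝓧]
  [mΩ : MeasurableSpace Ω] {ℱ : Filtration ℝ≥0 mΩ} {X : ℝ≥0 → Ω → 𝓧} {P : Kernel 𝓧 Ω}
  {μ μs : Measure 𝓧}

namespace IsMarkovFamily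

theorem measurable (hX : IsMarkovFamily ℱ X P) (t : ℝ≥0) : Measurable (X t) :=
  (hX.adapted t).mono (ℱ.le t) le_rfl

theorem apply_inter_preimage (hX : IsMarkovFamily ℱ X P) (x : 𝓧) (s t : ℝ≥0) {F : Set Ω}
    (hF : MeasurableSet[ℱ s] F) {A : Set 𝓧} (hA : MeasurableSet A) :
    P x (X (s + t) ⁻¹' A ∩ F) = ∫⁻ ω in F, P (X s ω) (X t ⁻¹' A) ∂(P x) := by
  have := hX.isMarkovKernel
  have hm : MeasurableSet (X (s + t) ⁻¹' A) := hX.measurable _ hA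
  have h1 := setIntegral_condExp (μ := P x) (ℱ.le s)
    (f := (X (s + t) ⁻¹' A).indicator fun _ => (1 : ℝ))
    ((integrable_const 1).indicator hm) hF
  rw [integral_congr_ae (ae_restrict_of_ae (hX.markov x s t A hA)), integral_indicator hm,
    setIntegral_const, smul_eq_mul, mul_one, measureReal_restrict_apply hm] at h1
  have hmk : Measurable fun ω => P (X s ω) (X t ⁻¹' A) :=
    (P.measurable_coe (hX.measurable t hA)).comp (hX.measurable s)
  simp only [measureReal_def] at h1
  rw [integral_toReal hmk.aemeasurable (Eventually.of_forall fun ω => measure_lt_top _ _)] at h1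
  have hne : ∫⁻ ω in F, P (X s ω) (X t ⁻¹' A) ∂(P x) ≠ ∞ := by
    refine ne_of_lt (lt_of_le_of_lt (lintegral_mono fun ω => prob_le_one) ?_)
    simp [measure_lt_top]
  exact ((ENNReal.toReal_eq_toReal_iff' hne (measure_ne_top _ _)).1 h1).symm

/-- The Markov property as an identity of measures: on an event of the past, the law at time `s + t`
is the law at time `s` pushed through the transition kernel. In this form it extends from `P x` to
`lawFrom P μ` and from sets to functions. -/
theorem map_restrict_lawFrom (hX : IsMarkovFamily ℱ X P) (s t : ℝ≥0) {F : Set Ω}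
    (hF : MeasurableSet[ℱ s] F) :
    ((lawFrom P μ).restrict F).map (X (s + t)) =
      (((lawFrom P μ).restrict F).map (X s)).bind (P.map (X t)) := by
  have hF' := ℱ.le s _ hF
  ext A hA
  have hmt := hX.measurable t
  have hmk : Measurable fun ω => P (X s ω) (X t ⁻¹' A) :=
    (P.measurable_coe (hmt hA)).comp (hX.measurable s)
  rw [Measure.map_apply (hX.measurable _) hA, Measure.restrict_apply (hX.measurable _ hA),
    lawFrom, Measure.bind_apply ((hX.measurable _ hA).inter hF') P.aemeasurable,
    Measure.bind_apply hA (Kernel.aemeasurable _),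
    lintegral_map (Kernel.measurable_coe _ hA) (hX.measurable s)]
  simp_rw [Kernel.map_apply' P hmt _ hA]
  rw [← lintegral_indicator hF', Measure.lintegral_bind P.aemeasurable
    (hmk.indicator hF').aemeasurable]
  refine lintegral_congr fun x => ?_
  rw [hX.apply_inter_preimage x s t hF hA, lintegral_indicator hF']

theorem transition_eq (hX : IsMarkovFamily ℱ X P) (t : ℝ≥0) {g : 𝓧 → ℝ} (hg : Measurable g)
    (y : 𝓧) : transition X P t g y = ∫ z, g z ∂(P.map (X t) y) := by
  rw [Kernel.map_apply _ (hX.measurable t),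
    integral_map (hX.measurable t).aemeasurable hg.aestronglyMeasurable, transition]

theorem measurable_transition (hX : IsMarkovFamily ℱ X P) (t : ℝ≥0) {g : 𝓧 → ℝ}
    (hg : Measurable g) : Measurable (transition X P t g) :=
  have := hX.isMarkovKernel
  measurable_integral_kernel (hg.comp (hX.measurable t))

theorem abs_transition_le (hX : IsMarkovFamily ℱ X P)
    (t : ℝ≥0) {g : 𝓧 → ℝ} {K : ℝ}
    (hK : ∀ x, |g x| ≤ K) (y : 𝓧) : |transition X P t g y| ≤ K :=
  have := hX.isMarkovKernel
  abs_integral_kernel_le (fun _ => hK _) y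

theorem integral_comp_eq (hX : IsMarkovFamily ℱ X P) (hinv : IsInvariant X P μs) (t : ℝ≥0)
    {g : 𝓧 → ℝ} (hg : AEStronglyMeasurable g μs) :
    ∫ ω, g (X t ω) ∂(lawFrom P μs) = ∫ x, g x ∂μs := by
  rw [← integral_map (f := g) (hX.measurable t).aemeasurable (by rwa [hinv t]), hinv t]

variable [IsProbabilityMeasure μ] [IsProbabilityMeasure μs]

theorem setIntegral_lawFrom (hX : IsMarkovFamily ℱ X P) (s t : ℝ≥0) {F : Set Ω}
    (hF : MeasurableSet[ℱ s] F) {g : 𝓧 → ℝ} (hg : Measurable g) {K : ℝ} (hK : ∀ x, |g x| ≤ K) :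
    ∫ ω in F, g (X (s + t) ω) ∂(lawFrom P μ) =
      ∫ ω in F, transition X P t g (X s ω) ∂(lawFrom P μ) := by
  have := hX.isMarkovKernel
  have : IsMarkovKernel (P.map (X t)) := Kernel.IsMarkovKernel.map _ (hX.measurable t)
  rw [← integral_map (f := g) (hX.measurable _).aemeasurable hg.aestronglyMeasurable,
    hX.map_restrict_lawFrom s t hF]
  change ∫ y, g y ∂(lawFrom (P.map (X t)) _) = _
  rw [integral_lawFrom]
  · rw [← integral_map (f := transition X P t g) (hX.measurable s).aemeasurable
      (hX.measurable_transition t hg).aestronglyMeasurable]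
    exact integral_congr_ae (Eventually.of_forall fun y => (hX.transition_eq t hg y).symm)
  · have : IsFiniteMeasure (lawFrom (P.map (X t)) (((lawFrom P μ).restrict F).map (X s))) := by
      unfold lawFrom; infer_instance
    exact integrable_of_abs_le hg hK

/-- The function `transition X P t g (X s ·)` is a version of the conditional expectation given `ℱ
s`, and the bounded `ℱ s`-measurable factor `Z` can be pulled out. -/
theorem integral_mul_lawFrom (hX : IsMarkovFamily ℱ X P) (s t : ℝ≥0) {Z : Ω → ℝ}
    (hZ : Measurable[ℱ s] Z) {L : ℝ} (hL : ∀ ω, |Z ω| ≤ L)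
    {g : 𝓧 → ℝ} (hg : Measurable g) {K : ℝ} (hK : ∀ x, |g x| ≤ K) :
    ∫ ω, Z ω * g (X (s + t) ω) ∂(lawFrom P μ) =
      ∫ ω, Z ω * transition X P t g (X s ω) ∂(lawFrom P μ) := by
  have := hX.isMarkovKernel
  have hgi : Integrable (fun ω => g (X (s + t) ω)) (lawFrom P μ) :=
    integrable_of_abs_le (hg.comp (hX.measurable _)) fun _ => hK _
  have hce : (fun ω => transition X P t g (X s ω)) =ᵐ[lawFrom P μ]
      (lawFrom P μ)[fun ω => g (X (s + t) ω) | ℱ s] := by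
    refine ae_eq_condExp_of_forall_setIntegral_eq (ℱ.le s) hgi (fun F _ _ => ?_)
      (fun F hF _ => (hX.setIntegral_lawFrom s t hF hg hK).symm) ?_
    · exact (integrable_of_abs_le ((hX.measurable_transition t hg).comp (hX.measurable s))
        fun _ => hX.abs_transition_le t hK _).integrableOn
    · exact ((hX.measurable_transition t hg).comp (hX.adapted s)).stronglyMeasurable
        |>.aestronglyMeasurable
  have hpull := condExp_stronglyMeasurable_mul_of_bound (μ := lawFrom P μ) (ℱ.le s)
    hZ.stronglyMeasurable hgi L (Eventually.of_forall hL)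
  rw [← integral_condExp (ℱ.le s)]
  refine integral_congr_ae ?_
  filter_upwards [hpull, hce] with ω h1 h2
  rw [h2]
  exact h1

/-- The function `w` is the `n`-fold iterate of `h ↦ 𝒫_ε (g h)` applied to `1`. The point is that
the same `w` serves every time `s` and every past factor `Z`. -/
theorem exists_integral_mul_prod (hX : IsMarkovFamily ℱ X P) (ε : ℝ≥0)
    {g : 𝓧 → ℝ} (hg : Measurable g) {K : ℝ} (hK : ∀ x, |g x| ≤ K) (n : ℕ) :
    ∃ w : 𝓧 → ℝ, Measurable w ∧ (∃ M, ∀ x, |w x| ≤ M) ∧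
      ∀ (s : ℝ≥0) (Z : Ω → ℝ), Measurable[ℱ s] Z → (∃ L, ∀ ω, |Z ω| ≤ L) →
        ∫ ω, Z ω * ∏ j ∈ Finset.range n, g (X (s + (j + 1) * ε) ω) ∂(lawFrom P μ) =
          ∫ ω, Z ω * w (X s ω) ∂(lawFrom P μ) := by
  induction n with
  | zero => exact ⟨fun _ => 1, measurable_const, ⟨1, by simp⟩, by simp⟩
  | succ n ih =>
    obtain ⟨w, hw, ⟨M, hM⟩, hwZ⟩ := ih
    have hgw : ∀ x, |g x * w x| ≤ K * M := fun x => by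
      rw [abs_mul]
      exact mul_le_mul (hK x) (hM x) (abs_nonneg _) ((abs_nonneg _).trans (hK x))
    refine ⟨transition X P ε fun x => g x * w x, hX.measurable_transition ε (hg.mul hw),
      ⟨K * M, hX.abs_transition_le ε hgw⟩, fun s Z hZ hL => ?_⟩
    obtain ⟨L, hL⟩ := hL
    rw [← hX.integral_mul_lawFrom s ε hZ hL (g := fun x => g x * w x) (hg.mul hw) hgw]
    -- The first factor of the product is known at time `s + ε`, so it joins `Z` when the induction
    -- hypothesis is applied there.
    have h1 := hwZ (s + ε) (fun ω => Z ω * g (X (s + ε) ω))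
      ((hZ.mono (ℱ.mono (by simp)) le_rfl).mul (hg.comp (hX.adapted _))) ⟨L * K, fun ω => by
        rw [abs_mul]
        exact mul_le_mul (hL ω) (hK _) (abs_nonneg _) ((abs_nonneg _).trans (hL ω))⟩
    simp_rw [mul_assoc] at h1
    rw [← h1]
    refine integral_congr_ae (Eventually.of_forall fun ω => ?_)
    simp only [Finset.prod_range_succ']
    rw [mul_comm (∏ k ∈ _, _)]
    congr 2
    · simp
    · refine Finset.prod_congr rfl fun j _ => ?_
      congr 2
      push_cast; ring

theorem initial_mem (hX : IsMarkovFamily ℱ X P) (x : 𝓧) {A : Set 𝓧} (hA : MeasurableSet A) :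
    ∀ᵐ ω ∂(P x), A.indicator (fun _ => (1 : ℝ)) (X 0 ω) = A.indicator (fun _ => (1 : ℝ)) x := by
  by_cases hx : x ∈ A
  · have h : P x (X 0 ⁻¹' Aᶜ) = 0 := by
      rw [← Measure.map_apply (hX.measurable 0) hA.compl, hX.initial x,
        Measure.dirac_apply' _ hA.compl]
      simp [hx]
    filter_upwards [measure_eq_zero_iff_ae_notMem.1 h] with ω hω
    have : X 0 ω ∈ A := by simpa using hω
    simp [hx, this]
  · have h : P x (X 0 ⁻¹' A) = 0 := by
      rw [← Measure.map_apply (hX.measurable 0) hA, hX.initial x, Measure.dirac_apply' _ hA]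
      simp [hx]
    filter_upwards [measure_eq_zero_iff_ae_notMem.1 h] with ω hω
    have : X 0 ω ∉ A := hω
    simp [hx, this]

theorem integral_indicator_initial_mul (hX : IsMarkovFamily ℱ X P) {A : Set 𝓧}
    (hA : MeasurableSet A) {Y : Ω → ℝ} (hY : Measurable Y) {K : ℝ} (hK : ∀ ω, |Y ω| ≤ K) :
    ∫ ω, A.indicator (fun _ => (1 : ℝ)) (X 0 ω) * Y ω ∂(lawFrom P μ) =
      ∫ x in A, ∫ ω, Y ω ∂(P x) ∂μ := by
  have := hX.isMarkovKernel
  have hm : Measurable fun ω => A.indicator (fun _ => (1 : ℝ)) (X 0 ω) :=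
    (measurable_const.indicator hA).comp (hX.measurable 0)
  rw [integral_lawFrom, ← integral_indicator hA]
  · refine integral_congr_ae (Eventually.of_forall fun x => ?_)
    simp only
    rw [integral_congr_ae (g := fun ω => A.indicator (fun _ => (1 : ℝ)) x * Y ω)
      ((hX.initial_mem x hA).mono fun ω hω => by simp only; rw [hω]), integral_const_mul]
    by_cases hx : x ∈ A <;> simp [hx]
  · refine integrable_of_abs_le (K := 1 * K) (hm.mul hY) fun ω => ?_
    rw [abs_mul]
    refine mul_le_mul ?_ (hK ω) (abs_nonneg _) zero_le_one
    by_cases hx : X 0 ω ∈ A <;> simp [hx]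

/-- Functions of the starting point that pair equally with all events `{X₀ ∈ A}` agree. -/
theorem ae_eq_of_integral_indicator_initial (hX : IsMarkovFamily ℱ X P) {Y : Ω → ℝ}
    (hY : Measurable Y) {K : ℝ} (hK : ∀ ω, |Y ω| ≤ K) {Y' : Ω → ℝ} (hY' : Measurable Y')
    {K' : ℝ} (hK' : ∀ ω, |Y' ω| ≤ K')
    (h : ∀ A : Set 𝓧, MeasurableSet A →
      ∫ ω, A.indicator (fun _ => (1 : ℝ)) (X 0 ω) * Y ω ∂(lawFrom P μ) =
        ∫ ω, A.indicator (fun _ => (1 : ℝ)) (X 0 ω) * Y' ω ∂(lawFrom P μ)) :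
    (fun x => ∫ ω, Y ω ∂(P x)) =ᵐ[μ] fun x => ∫ ω, Y' ω ∂(P x) := by
  have := hX.isMarkovKernel
  refine Integrable.ae_eq_of_forall_setIntegral_eq _ _
    (integrable_of_abs_le (measurable_integral_kernel hY) fun x => abs_integral_kernel_le hK x)
    (integrable_of_abs_le (measurable_integral_kernel hY') fun x => abs_integral_kernel_le hK' x)
    fun A hA _ => ?_
  rw [← hX.integral_indicator_initial_mul hA hY hK, h A hA,
    hX.integral_indicator_initial_mul hA hY' hK']

/-- For merely measurable `V` the paths of `V(X_s)` need not be right-continuous. Approximate `V` in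
`L¹(μs)` by a bounded continuous `g`: invariance makes the error the same at all times, and `g(X_s)`
is handled by right-continuity of paths and dominated convergence. -/
theorem isL1RightCts [PolishSpace 𝓧] [BorelSpace 𝓧] (hX : IsMarkovFamily ℱ X P) (hinv : IsInvariant X P μs) {V : 𝓧 → ℝ}
    (hV : Measurable V) {K : ℝ} (hK : ∀ x, |V x| ≤ K) :
    IsL1RightCts (lawFrom P μs) (fun s ω => V (X s.toNNReal ω)) K where
  measurable := hV.comp (measurable_uncurry_of_isCadlag hX.measurable hX.cadlag)
  bound s ω := hK _
  tendsto t := by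
    have := hX.isMarkovKernel
    let _ := TopologicalSpace.upgradeIsCompletelyMetrizable 𝓧
    have hVi : Integrable V μs := integrable_of_abs_le hV hK
    rw [Metric.tendsto_nhds]
    intro ε hε
    -- The error `ε / 4` is paid at both times, leaving `ε / 2` for the increment of `g(X)`.
    obtain ⟨g, hg, -⟩ := hVi.exists_boundedContinuous_integral_sub_le (ε := ε / 4) (by positivity)
    have hgm : Measurable g := g.continuous.measurable
    have hgK : ∀ x, |g x| ≤ ‖g‖ := fun x => g.norm_coe_le_norm x
    have hgt : Tendsto (fun s : ℝ => ∫ ω, |g (X s.toNNReal ω) - g (X t.toNNReal ω)|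
        ∂(lawFrom P μs)) (𝓝[≥] t) (𝓝 (∫ ω, (0 : ℝ) ∂(lawFrom P μs))) := by
      refine tendsto_integral_filter_of_dominated_convergence (fun _ => ‖g‖ + ‖g‖)
        (Eventually.of_forall fun s => ?_)
        (Eventually.of_forall fun s => Eventually.of_forall fun ω => ?_) (integrable_const _)
        (Eventually.of_forall fun ω => ?_)
      · exact ((hgm.comp (hX.measurable _)).sub (hgm.comp (hX.measurable _))).abs
          |>.aestronglyMeasurable
      · rw [Real.norm_eq_abs, abs_abs]
        exact (abs_sub _ _).trans (add_le_add (hgK _) (hgK _))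
      · have h1 := (g.continuous.tendsto _).comp ((hX.cadlag ω).tendsto_toNNReal t)
        have h2 := (h1.sub_const (g (X t.toNNReal ω))).abs
        simpa using h2
    rw [integral_zero] at hgt
    filter_upwards [hgt.eventually (gt_mem_nhds (half_pos hε))] with s hs
    rw [dist_zero_right, Real.norm_of_nonneg (integral_nonneg fun _ => abs_nonneg _)]
    have hd : ∀ r : ℝ, ∫ ω, |V (X r.toNNReal ω) - g (X r.toNNReal ω)| ∂(lawFrom P μs)
        ≤ ε / 4 := fun r => by
      rw [hX.integral_comp_eq hinv r.toNNReal (g := fun x => |V x - g x|)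
        (hV.sub hgm).abs.aestronglyMeasurable]
      exact hg
    have hi : ∀ r : ℝ, Integrable (fun ω => |V (X r.toNNReal ω) - g (X r.toNNReal ω)|)
        (lawFrom P μs) := fun r =>
      integrable_of_abs_le (K := K + ‖g‖)
        ((hV.comp (hX.measurable _)).sub (hgm.comp (hX.measurable _))).abs fun ω => by
          rw [abs_abs]; exact (abs_sub _ _).trans (add_le_add (hK _) (hgK _))
    have hi2 : Integrable (fun ω => |g (X s.toNNReal ω) - g (X t.toNNReal ω)|)
        (lawFrom P μs) :=
      integrable_of_abs_le (K := ‖g‖ + ‖g‖)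
        ((hgm.comp (hX.measurable _)).sub (hgm.comp (hX.measurable _))).abs fun ω => by
          rw [abs_abs]; exact (abs_sub _ _).trans (add_le_add (hgK _) (hgK _))
    calc ∫ ω, |V (X s.toNNReal ω) - V (X t.toNNReal ω)| ∂(lawFrom P μs)
        ≤ ∫ ω, (|V (X s.toNNReal ω) - g (X s.toNNReal ω)|
            + |g (X s.toNNReal ω) - g (X t.toNNReal ω)|
            + |V (X t.toNNReal ω) - g (X t.toNNReal ω)|) ∂(lawFrom P μs) := by
          refine integral_mono_of_nonneg (Eventually.of_forall fun _ => abs_nonneg _)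
            (((hi s).add hi2).add (hi t)) (Eventually.of_forall fun ω => ?_)
          have h1 := abs_sub_le (V (X s.toNNReal ω)) (g (X s.toNNReal ω)) (V (X t.toNNReal ω))
          have h2 := abs_sub_le (g (X s.toNNReal ω)) (g (X t.toNNReal ω)) (V (X t.toNNReal ω))
          rw [abs_sub_comm (g (X t.toNNReal ω)) (V (X t.toNNReal ω))] at h2
          simp only
          linarith
      _ < ε := by
          have h3 := integral_add ((hi s).add hi2) (hi t)
          have h4 := integral_add (hi s) hi2
          simp only [Pi.add_apply] at h3
          rw [h3, h4]
          linarith [hd s, hd t]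

end IsMarkovFamily

end Markov

/-! ### Exponential estimates and difference quotients. -/

section Estimates

theorem abs_exp_sub_exp_le {x y M : ℝ} (hx : |x| ≤ M) (hy : |y| ≤ M) :
    |Real.exp x - Real.exp y| ≤ Real.exp M * |x - y| := by
  have key : ∀ {x y : ℝ}, |x| ≤ M → Real.exp x - Real.exp y ≤ Real.exp M * |x - y| := by
    intro x y hx
    have h1 := Real.add_one_le_exp (y - x)
    have h2 : Real.exp y = Real.exp x * Real.exp (y - x) := by rw [← Real.exp_add]; ring_nf
    have h3 : Real.exp x ≤ Real.exp M := Real.exp_le_exp.2 ((le_abs_self x).trans hx)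
    calc Real.exp x - Real.exp y = Real.exp x * (1 - Real.exp (y - x)) := by rw [h2]; ring
      _ ≤ Real.exp x * |x - y| := by
        have := le_abs_self (x - y)
        gcongr
        linarith
      _ ≤ _ := by gcongr
  refine abs_sub_le_iff.2 ⟨key hx, ?_⟩
  rw [abs_sub_comm]; exact key hy

theorem abs_exp_le {x M : ℝ} (hx : |x| ≤ M) : |Real.exp x| ≤ Real.exp M := by
  rw [abs_of_pos (Real.exp_pos x)]
  exact Real.exp_le_exp.2 ((le_abs_self x).trans hx)

variable {Ω : Type*} [MeasurableSpace Ω] {Q : Measure Ω} [IsProbabilityMeasure Q]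

theorem eLpNorm_two_le_of_abs_le {k : Ω → ℝ} {M : ℝ} (hk : Measurable k) (hM : ∀ ω, |k ω| ≤ M) :
    eLpNorm k 2 Q ≤ ENNReal.ofReal (√(M * ∫ ω, |k ω| ∂Q)) := by
  have hmem : MemLp k 2 Q :=
    MemLp.of_bound hk.aestronglyMeasurable M (Eventually.of_forall hM)
  rw [hmem.eLpNorm_eq_integral_rpow_norm (by norm_num) (by norm_num), Real.sqrt_eq_rpow]
  refine ENNReal.ofReal_le_ofReal ?_
  have h : ∫ ω, ‖k ω‖ ^ (2 : ℝ≥0∞).toReal ∂Q ≤ M * ∫ ω, |k ω| ∂Q := by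
    rw [← integral_const_mul]
    refine integral_mono_of_nonneg (Eventually.of_forall fun _ => by positivity)
      ((integrable_of_abs_le hk hM).abs.const_mul M) (Eventually.of_forall fun ω => ?_)
    simp only [ENNReal.toReal_ofNat, Real.rpow_two, Real.norm_eq_abs]
    rw [sq]
    exact mul_le_mul_of_nonneg_right (hM ω) (abs_nonneg _)
  have h2 : ((2 : ℝ≥0∞).toReal)⁻¹ = 1 / 2 := by norm_num
  rw [h2]
  exact Real.rpow_le_rpow (integral_nonneg fun _ => by positivity) h (by norm_num)

/-- A uniformly bounded family converging in `L¹` converges in `L²`. -/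
theorem tendsto_eLpNorm_two_of_abs_le {ι : Type*} {l : Filter ι} {k : ι → Ω → ℝ} {M : ℝ}
    (hk : ∀ i, Measurable (k i)) (hM : ∀ᶠ i in l, ∀ ω, |k i ω| ≤ M)
    (h0 : Tendsto (fun i => ∫ ω, |k i ω| ∂Q) l (𝓝 0)) :
    Tendsto (fun i => eLpNorm (k i) 2 Q) l (𝓝 0) := by
  have h1 : Tendsto (fun i => ENNReal.ofReal (√(M * ∫ ω, |k i ω| ∂Q))) l (𝓝 0) := by
    have := ENNReal.tendsto_ofReal ((Real.continuous_sqrt.tendsto _).comp (h0.const_mul M))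
    simpa [Function.comp_def] using this
  refine tendsto_of_tendsto_of_tendsto_of_le_of_le' tendsto_const_nhds h1
    (Eventually.of_forall fun _ => zero_le) ?_
  filter_upwards [hM] with i hi
  exact eLpNorm_two_le_of_abs_le (hk i) hi

/-- Differentiation of an exponential in `L¹`. -/
theorem tendsto_integral_exp_difference_quotient {I D₀ : Ω → ℝ} {D : ℝ → Ω → ℝ} {M L L₀ : ℝ}
    (hIM : ∀ ω, |I ω| ≤ M) (hDm : ∀ r, Measurable (D r)) (hDL : ∀ r, 0 < r → ∀ ω, |D r ω| ≤ L * r)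
    (hD₀ : Measurable D₀) (hD₀L : ∀ ω, |D₀ ω| ≤ L₀)
    (hlim : Tendsto (fun r => ∫ ω, |D r ω / r - D₀ ω| ∂Q) (𝓝[>] 0) (𝓝 0)) :
    Tendsto (fun r => ∫ ω, |(Real.exp (I ω + D r ω) - Real.exp (I ω)) / r
      - Real.exp (I ω) * D₀ ω| ∂Q) (𝓝[>] 0) (𝓝 0) := by
  have hr0 : Tendsto (fun r : ℝ => r) (𝓝[>] 0) (𝓝 0) := tendsto_id.mono_left nhdsWithin_le_nhds
  have hup : Tendsto (fun r => Real.exp M * (L ^ 2 * r + ∫ ω, |D r ω / r - D₀ ω| ∂Q))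
      (𝓝[>] 0) (𝓝 0) := by
    have := ((hr0.const_mul (L ^ 2)).add hlim).const_mul (Real.exp M)
    simpa using this
  have hsmall : ∀ᶠ r : ℝ in 𝓝[>] 0, L * r < 1 := by
    have := hr0.const_mul L
    rw [mul_zero] at this
    exact this.eventually (gt_mem_nhds zero_lt_one)
  refine tendsto_of_tendsto_of_tendsto_of_le_of_le' tendsto_const_nhds hup
    (Eventually.of_forall fun _ => integral_nonneg fun _ => abs_nonneg _) ?_
  filter_upwards [hsmall, self_mem_nhdsWithin] with r hr1 (hr : 0 < r)
  have hint : Integrable (fun ω => |D r ω / r - D₀ ω|) Q :=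
    integrable_of_abs_le (K := L + L₀) (((hDm r).div_const r).sub hD₀).abs fun ω => by
      rw [abs_abs]
      refine (abs_sub _ _).trans (add_le_add ?_ (hD₀L ω))
      rw [abs_div, abs_of_pos hr, div_le_iff₀ hr]
      exact hDL r hr ω
  have hrhs : Real.exp M * (L ^ 2 * r + ∫ ω, |D r ω / r - D₀ ω| ∂Q)
      = ∫ ω, Real.exp M * (L ^ 2 * r + |D r ω / r - D₀ ω|) ∂Q := by
    rw [integral_const_mul, integral_add (integrable_const _) hint]
    simp
  rw [hrhs]
  refine integral_mono_of_nonneg (Eventually.of_forall fun _ => abs_nonneg _)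
    (((integrable_const _).add hint).const_mul _) (Eventually.of_forall fun ω => ?_)
  have hd := hDL r hr ω
  have h1 := Real.abs_exp_sub_one_sub_id_le (hd.trans hr1.le)
  have h2 : (D r ω) ^ 2 ≤ (L * r) ^ 2 := sq_le_sq' (by linarith [abs_le.1 hd]) (abs_le.1 hd).2
  -- Split off the second-order remainder of `exp` at `0`; it is at most `(L r)²`, so it still
  -- vanishes after division by `r`.
  have h3 : (Real.exp (I ω + D r ω) - Real.exp (I ω)) / r - Real.exp (I ω) * D₀ ω
      = Real.exp (I ω) * ((Real.exp (D r ω) - 1 - D r ω) / r + (D r ω / r - D₀ ω)) := by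
    rw [Real.exp_add]; field_simp; ring
  simp only
  rw [h3, abs_mul]
  refine mul_le_mul (abs_exp_le (hIM ω)) ?_ (abs_nonneg _) (Real.exp_pos _).le
  refine (abs_add_le _ _).trans (add_le_add ?_ le_rfl)
  rw [abs_div, abs_of_pos hr, div_le_iff₀ hr]
  calc _ ≤ (L * r) ^ 2 := h1.trans h2
    _ = L ^ 2 * r * r := by ring

end Estimates

/-! ### The Feynman-Kac functional and its Markov property. -/

section FeynmanKac

variable {𝓧 Ω : Type*} [TopologicalSpace 𝓧] [PolishSpace 𝓧] [MeasurableSpace 𝓧] [BorelSpace 𝓧]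
  [mΩ : MeasurableSpace Ω] {ℱ : Filtration ℝ≥0 mΩ} {X : ℝ≥0 → Ω → 𝓧} {P : Kernel 𝓧 Ω}
  {μs : Measure 𝓧} [IsProbabilityMeasure μs] {V : 𝓧 → ℝ} {K : ℝ}

/-- The functional `E^x[exp(∫₀ᵗ V(X_s) ds)]` of Feynman and Kac. -/
noncomputable def feynmanKac {𝓧 Ω : Type*} [MeasurableSpace 𝓧] [MeasurableSpace Ω]
    (X : ℝ≥0 → Ω → 𝓧) (P : Kernel 𝓧 Ω) (V : 𝓧 → ℝ) (t : ℝ) (x : 𝓧) : ℝ :=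
  ∫ ω, Real.exp (∫ s in 0..t, V (X s.toNNReal ω)) ∂(P x)

theorem abs_integral_mul_sub_le {Ω : Type*} [MeasurableSpace Ω] {Q : Measure Ω}
    [IsFiniteMeasure Q] {Z Y Y' : Ω → ℝ} {L M M' : ℝ} (hZ : Measurable Z)
    (hL : ∀ ω, |Z ω| ≤ L) (hY : Measurable Y) (hM : ∀ ω, |Y ω| ≤ M) (hY' : Measurable Y')
    (hM' : ∀ ω, |Y' ω| ≤ M') :
    |∫ ω, Z ω * Y ω ∂Q - ∫ ω, Z ω * Y' ω ∂Q| ≤ L * ∫ ω, |Y ω - Y' ω| ∂Q := by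
  have hb : ∀ {W : Ω → ℝ} {N : ℝ}, Measurable W → (∀ ω, |W ω| ≤ N) →
      Integrable (fun ω => Z ω * W ω) Q := fun {W N} hW hN =>
    integrable_of_abs_le (K := L * N) (hZ.mul hW) fun ω => by
      rw [abs_mul]
      exact mul_le_mul (hL ω) (hN ω) (abs_nonneg _) ((abs_nonneg _).trans (hL ω))
  rw [← integral_sub (hb hY hM) (hb hY' hM'), ← integral_const_mul]
  refine abs_integral_le_integral_abs.trans (integral_mono_of_nonneg
    (Eventually.of_forall fun _ => abs_nonneg _)
    (((integrable_of_abs_le hY hM).sub (integrable_of_abs_le hY' hM')).abs.const_mul L)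
    (Eventually.of_forall fun ω => ?_))
  simp only
  rw [← mul_sub, abs_mul]
  exact mul_le_mul_of_nonneg_right (hL ω) (abs_nonneg _)

namespace IsMarkovFamily

theorem measurable_exp_integral (hX : IsMarkovFamily ℱ X P) (hinv : IsInvariant X P μs)
    (hV : Measurable V) (hK : ∀ x, |V x| ≤ K) (a b : ℝ) :
    Measurable fun ω => Real.exp (∫ s in a..b, V (X s.toNNReal ω)) :=
  ((hX.isL1RightCts hinv hV hK).measurable_intervalIntegral a b).exp

theorem abs_exp_integral_le (hX : IsMarkovFamily ℱ X P) (hinv : IsInvariant X P μs)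
    (hV : Measurable V) (hK : ∀ x, |V x| ≤ K) (a b : ℝ) (ω : Ω) :
    |Real.exp (∫ s in a..b, V (X s.toNNReal ω))| ≤ Real.exp (K * |b - a|) :=
  abs_exp_le ((hX.isL1RightCts hinv hV hK).abs_intervalIntegral_le ω a b)

theorem measurable_feynmanKac (hX : IsMarkovFamily ℱ X P) (hinv : IsInvariant X P μs)
    (hV : Measurable V) (hK : ∀ x, |V x| ≤ K) (t : ℝ) : Measurable (feynmanKac X P V t) :=
  have := hX.isMarkovKernel
  measurable_integral_kernel (hX.measurable_exp_integral hinv hV hK 0 t)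

theorem abs_feynmanKac_le (hX : IsMarkovFamily ℱ X P) (hinv : IsInvariant X P μs)
    (hV : Measurable V) (hK : ∀ x, |V x| ≤ K) (t : ℝ) (x : 𝓧) :
    |feynmanKac X P V t x| ≤ Real.exp (K * |t|) := by
  have := hX.isMarkovKernel
  have := abs_integral_kernel_le (P := P) (hX.abs_exp_integral_le hinv hV hK 0 t) x
  rwa [sub_zero] at this

/-- The Markov property for the Feynman-Kac functional, by approximation with Riemann sums. -/
theorem integral_mul_exp_integral (hX : IsMarkovFamily ℱ X P) (hinv : IsInvariant X P μs)
    (hV : Measurable V) (hK : ∀ x, |V x| ≤ K) (a : ℝ≥0) {t : ℝ} (ht : 0 < t) {Z : Ω → ℝ}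
    (hZ : Measurable[ℱ a] Z) {L : ℝ} (hL : ∀ ω, |Z ω| ≤ L) :
    ∫ ω, Z ω * Real.exp (∫ s in 0..t, V (X (a + s).toNNReal ω)) ∂(lawFrom P μs) =
      ∫ ω, Z ω * feynmanKac X P V t (X a ω) ∂(lawFrom P μs) := by
  have := hX.isMarkovKernel
  have hZ' : Measurable Z := hZ.mono (ℱ.le a) le_rfl
  have hv := hX.isL1RightCts hinv hV hK
  set ε : ℕ → ℝ := fun n => t / ((n : ℝ) + 1) with hεd
  have hε : ∀ n, 0 < ε n := fun n => by positivity
  -- The exponential of a Riemann sum is a product over grid times, to which the Markov property for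
  -- products applies. The shift `b` is used with the values `a` and `0`.
  let R : ℝ≥0 → ℕ → Ω → ℝ := fun b n ω => ∑ j ∈ Finset.range (n + 1),
    ε n * V (X ((b : ℝ) + (j + 1) * ε n).toNNReal ω)
  let J : ℝ≥0 → Ω → ℝ := fun b ω => ∫ s in 0..t, V (X ((b : ℝ) + s).toNNReal ω)
  have hRm : ∀ b n, Measurable (R b n) := fun b n =>
    Finset.measurable_fun_sum _ fun j _ => (hV.comp (hX.measurable _)).const_mul _
  have hJm : ∀ b, Measurable (J b) := fun b => (hv.shift b).measurable_intervalIntegral 0 t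
  have hR : ∀ b n ω, |R b n ω| ≤ K * t := fun b n ω => by
    calc |R b n ω| ≤ ∑ j ∈ Finset.range (n + 1),
        |ε n * V (X ((b : ℝ) + (j + 1) * ε n).toNNReal ω)| := Finset.abs_sum_le_sum_abs _ _
      _ ≤ ∑ j ∈ Finset.range (n + 1), ε n * K := by
        refine Finset.sum_le_sum fun j _ => ?_
        rw [abs_mul, abs_of_pos (hε n)]
        exact mul_le_mul_of_nonneg_left (hK _) (hε n).le
      _ = K * t := by
        rw [Finset.sum_const, Finset.card_range, nsmul_eq_mul, hεd]
        push_cast; field_simp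
  have hJ : ∀ b ω, |J b ω| ≤ K * t := fun b ω => by
    have := (hv.shift b).abs_intervalIntegral_le ω 0 t
    rwa [sub_zero, abs_of_pos ht] at this
  have hlim : ∀ b : ℝ≥0, Tendsto (fun n => ∫ ω, |Real.exp (R b n ω) - Real.exp (J b ω)|
      ∂(lawFrom P μs)) atTop (𝓝 0) := fun b => by
    have h1 := ((hv.shift b).tendsto_riemannSum (Q := lawFrom P μs) ht).const_mul
      (Real.exp (K * t))
    rw [mul_zero] at h1
    refine squeeze_zero (fun n => integral_nonneg fun _ => abs_nonneg _) (fun n => ?_) h1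
    rw [← integral_const_mul]
    refine integral_mono_of_nonneg (Eventually.of_forall fun _ => abs_nonneg _)
      (Integrable.const_mul (integrable_of_abs_le (K := K * t + K * t)
        ((hRm b n).sub (hJm b)).abs fun ω => ?_) _)
      (Eventually.of_forall fun ω => abs_exp_sub_exp_le (hR b n ω) (hJ b ω))
    rw [abs_abs]
    exact (abs_sub _ _).trans (add_le_add (hR b n ω) (hJ b ω))
  have hbR : ∀ b n ω, |Real.exp (R b n ω)| ≤ Real.exp (K * t) := fun b n ω => abs_exp_le (hR b n ω)
  have hbJ : ∀ b ω, |Real.exp (J b ω)| ≤ Real.exp (K * t) := fun b ω => abs_exp_le (hJ b ω)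
  -- the two sides along the grid
  have hgrid : ∀ n, ∫ ω, Z ω * Real.exp (R a n ω) ∂(lawFrom P μs) =
      ∫ ω, Z ω * (∫ ω', Real.exp (R 0 n ω') ∂(P (X a ω))) ∂(lawFrom P μs) := fun n => by
    have hgK : ∀ x, |Real.exp (ε n * V x)| ≤ Real.exp (ε n * K) := fun x => abs_exp_le (by
      rw [abs_mul, abs_of_pos (hε n)]
      exact mul_le_mul_of_nonneg_left (hK _) (hε n).le)
    have hgm : Measurable fun x => Real.exp (ε n * V x) := (hV.const_mul _).exp
    obtain ⟨w, hw, ⟨M, hM⟩, hwZ⟩ := hX.exists_integral_mul_prod (μ := μs) (ε n).toNNReal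
      (g := fun x => Real.exp (ε n * V x)) hgm hgK (n + 1)
    have hprod : ∀ (b : ℝ≥0) ω, ∏ j ∈ Finset.range (n + 1),
        Real.exp (ε n * V (X (b + ((j : ℝ≥0) + 1) * (ε n).toNNReal) ω)) = Real.exp (R b n ω) :=
      fun b ω => by
        rw [← Real.exp_sum]
        congr 1
        refine Finset.sum_congr rfl fun j _ => ?_
        have : ((b : ℝ) + (j + 1) * ε n).toNNReal = b + ((j : ℝ≥0) + 1) * (ε n).toNNReal := by
          have hj : (0 : ℝ) ≤ (j : ℝ) + 1 := by positivity
          rw [Real.toNNReal_add b.coe_nonneg (mul_nonneg hj (hε n).le), Real.toNNReal_coe,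
            Real.toNNReal_mul hj, Real.toNNReal_add (Nat.cast_nonneg j) zero_le_one,
            Real.toNNReal_natCast, Real.toNNReal_one]
        rw [this]
    simp_rw [hprod] at hwZ
    -- Testing the product identity at time `0` against events of the starting point identifies `w`
    -- almost everywhere.
    have hae : (fun x => ∫ ω, Real.exp (R 0 n ω) ∂(P x)) =ᵐ[μs] w := by
      have h1 := hX.ae_eq_of_integral_indicator_initial (μ := μs) (hRm 0 n).exp (hbR 0 n)
        (Y' := fun ω => w (X 0 ω)) (hw.comp (hX.measurable 0)) (fun ω => hM _) fun A hA =>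
          hwZ 0 _ ((measurable_const.indicator hA).comp (hX.adapted 0)) ⟨1, fun ω => by
            by_cases h : X 0 ω ∈ A <;> simp [h]⟩
      refine h1.trans (Eventually.of_forall fun x => ?_)
      simp only
      rw [← integral_map (f := w) (hX.measurable 0).aemeasurable hw.aestronglyMeasurable,
        hX.initial x, integral_dirac' _ _ hw.stronglyMeasurable]
    rw [hwZ a Z hZ ⟨L, hL⟩]
    -- Under invariance `X a` has law `μs`, so the identification persists at time `a`.
    have hae2 : ∀ᵐ ω ∂(lawFrom P μs), ∫ ω', Real.exp (R 0 n ω') ∂(P (X a ω)) = w (X a ω) := by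
      refine ae_of_ae_map (hX.measurable a).aemeasurable (p := fun y =>
        ∫ ω', Real.exp (R 0 n ω') ∂(P y) = w y) ?_
      rw [hinv a]
      exact hae
    refine integral_congr_ae (hae2.mono fun ω hω => ?_)
    simp only
    rw [hω]
  have hFK : ∀ x, feynmanKac X P V t x = ∫ ω, Real.exp (J 0 ω) ∂(P x) := fun x => by
    simp [feynmanKac, J]
  have t1 : Tendsto (fun n => ∫ ω, Z ω * Real.exp (R a n ω) ∂(lawFrom P μs)) atTop
      (𝓝 (∫ ω, Z ω * Real.exp (J a ω) ∂(lawFrom P μs))) := by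
    rw [tendsto_iff_dist_tendsto_zero]
    have h1 := (hlim a).const_mul L
    rw [mul_zero] at h1
    refine squeeze_zero (fun n => dist_nonneg) (fun n => ?_) h1
    exact abs_integral_mul_sub_le hZ' hL (hRm a n).exp (hbR a n) (hJm a).exp (hbJ a)
  have hmR : ∀ n, Measurable fun x => ∫ ω, Real.exp (R 0 n ω) ∂(P x) := fun n =>
    measurable_integral_kernel (hRm 0 n).exp
  have hmJ : Measurable fun x => ∫ ω, Real.exp (J 0 ω) ∂(P x) :=
    measurable_integral_kernel (hJm 0).exp
  have t2 : Tendsto (fun n => ∫ ω, Z ω * (∫ ω', Real.exp (R 0 n ω') ∂(P (X a ω)))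
      ∂(lawFrom P μs)) atTop (𝓝 (∫ ω, Z ω * feynmanKac X P V t (X a ω) ∂(lawFrom P μs))) := by
    simp_rw [hFK]
    rw [tendsto_iff_dist_tendsto_zero]
    have h1 := (hlim 0).const_mul L
    rw [mul_zero] at h1
    have hL0 : 0 ≤ L := by
      obtain ⟨ω⟩ : Nonempty Ω := nonempty_of_isProbabilityMeasure (lawFrom P μs)
      exact (abs_nonneg _).trans (hL ω)
    refine squeeze_zero (fun n => dist_nonneg) (fun n => ?_) h1
    refine (abs_integral_mul_sub_le hZ' hL ((hmR n).comp (hX.measurable a))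
      (fun ω => abs_integral_kernel_le (hbR 0 n) _) (hmJ.comp (hX.measurable a))
      (fun ω => abs_integral_kernel_le (hbJ 0) _)).trans ?_
    refine mul_le_mul_of_nonneg_left ?_ hL0
    refine le_trans (le_of_eq ?_) (integral_abs_integral_sub_le (μ := μs) (hRm 0 n).exp
      (hJm 0).exp (hbR 0 n) (hbJ 0))
    exact hX.integral_comp_eq hinv a (g := fun x => |∫ ω, Real.exp (R 0 n ω) ∂(P x) -
      ∫ ω, Real.exp (J 0 ω) ∂(P x)|) ((hmR n).sub hmJ).abs.aestronglyMeasurable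
  simp_rw [hgrid] at t1
  exact tendsto_nhds_unique t1 t2

/-- Apply the Markov property at time `a` with past factor `1_A(X_0)`; letting `A` vary recovers the
identity as functions of the starting point. -/
theorem transition_feynmanKac (hX : IsMarkovFamily ℱ X P) (hinv : IsInvariant X P μs)
    (hV : Measurable V) (hK : ∀ x, |V x| ≤ K) (a : ℝ≥0) {t : ℝ} (ht : 0 ≤ t) :
    transition X P a (feynmanKac X P V t) =ᵐ[μs]
      fun x => ∫ ω, Real.exp (∫ s in (a : ℝ)..a + t, V (X s.toNNReal ω)) ∂(P x) := by
  have := hX.isMarkovKernel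
  rcases ht.eq_or_lt with rfl | ht
  · refine Eventually.of_forall fun x => ?_
    simp [transition, feynmanKac]
  refine hX.ae_eq_of_integral_indicator_initial
    ((hX.measurable_feynmanKac hinv hV hK t).comp (hX.measurable a))
    (fun ω => hX.abs_feynmanKac_le hinv hV hK t _) (hX.measurable_exp_integral hinv hV hK _ _)
    (fun ω => hX.abs_exp_integral_le hinv hV hK _ _ ω) fun A hA => ?_
  have h1 := hX.integral_mul_exp_integral hinv hV hK a ht
    (Z := fun ω => A.indicator (fun _ => (1 : ℝ)) (X 0 ω)) (L := 1)
    (((measurable_const.indicator hA).comp (hX.adapted 0)).mono (ℱ.mono zero_le) le_rfl)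
    fun ω => by by_cases h : X 0 ω ∈ A <;> simp [h]
  refine Eq.trans h1.symm (integral_congr_ae (Eventually.of_forall fun ω => ?_))
  simp only
  rw [intervalIntegral.integral_comp_add_left (fun s => V (X s.toNNReal ω)), add_zero]

end IsMarkovFamily

end FeynmanKac

/-! ### Bounded functions as elements of `L²`. -/

section BoundedLp

variable {α : Type*} [MeasurableSpace α] {μ : Measure α} [IsFiniteMeasure μ]

/-- A bounded measurable function as an element of `L²`. -/
noncomputable def boundedLp (μ : Measure α) [IsFiniteMeasure μ] {f : α → ℝ} {K : ℝ}
    (hf : Measurable f) (hK : ∀ x, |f x| ≤ K) : Lp ℝ 2 μ :=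
  (MemLp.of_bound hf.aestronglyMeasurable K (Eventually.of_forall hK) : MemLp f 2 μ).toLp f

theorem coeFn_boundedLp {f : α → ℝ} {K : ℝ} (hf : Measurable f) (hK : ∀ x, |f x| ≤ K) :
    boundedLp μ hf hK =ᵐ[μ] f := MemLp.coeFn_toLp _

theorem norm_boundedLp_sub_le [IsProbabilityMeasure μ] {f g : α → ℝ} {K K' C : ℝ}
    (hf : Measurable f) (hK : ∀ x, |f x| ≤ K) (hg : Measurable g) (hK' : ∀ x, |g x| ≤ K')
    (hC : 0 ≤ C) (h : ∀ x, |f x - g x| ≤ C) :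
    ‖boundedLp μ hf hK - boundedLp μ hg hK'‖ ≤ C := by
  have := Lp.norm_le_of_ae_bound (f := boundedLp μ hf hK - boundedLp μ hg hK') (C := C) hC (by
    filter_upwards [Lp.coeFn_sub (boundedLp μ hf hK) (boundedLp μ hg hK'),
      coeFn_boundedLp (μ := μ) hf hK, coeFn_boundedLp (μ := μ) hg hK'] with x h1 h2 h3
    rw [h1, Pi.sub_apply, h2, h3]
    exact h x)
  simpa [measureUnivNNReal] using this

end BoundedLp

/-! ### Growth of a quadratic form along a curve. -/

section Energy

/-- Grönwall's inequality for a quadratic form along a right-differentiable curve. -/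
theorem bilin_self_le_exp {E : Type*} [NormedAddCommGroup E] [NormedSpace ℝ E]
    (B : E →L[ℝ] E →L[ℝ] ℝ) (hB : ∀ g h, B g h = B h g) {U U' : ℝ → E} {T Λ : ℝ} (hT : 0 ≤ T)
    (hU : ContinuousOn U (Icc 0 T))
    (hU' : ∀ t ∈ Ico 0 T, HasDerivWithinAt U (U' t) (Ici t) t)
    (h : ∀ t ∈ Ico 0 T, B (U' t) (U t) ≤ Λ * B (U t) (U t)) :
    B (U T) (U T) ≤ B (U 0) (U 0) * Real.exp (2 * Λ * T) := by
  have hd : ∀ t ∈ Ico 0 T, HasDerivWithinAt (fun s => B (U s) (U s))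
      (B (U t) (U' t) + B (U' t) (U t)) (Ici t) t := fun t ht =>
    B.hasDerivWithinAt_of_bilinear (hU' t ht) (hU' t ht)
  have hc : ContinuousOn (fun s => B (U s) (U s)) (Icc 0 T) :=
    (B.continuous.comp_continuousOn hU).clm_apply hU
  have key := le_gronwallBound_of_liminf_deriv_right_le (f := fun s => B (U s) (U s))
    (f' := fun t => B (U t) (U' t) + B (U' t) (U t)) (δ := B (U 0) (U 0)) (K := 2 * Λ) (ε := 0)
    hc (fun t ht r hr => by
      have := (hd t ht).liminf_right_slope_le hr
      simpa only [slope_def_field, div_eq_inv_mul] using this) le_rfl (fun t ht => by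
      rw [hB (U t) (U' t)]
      linarith [h t ht]) T ⟨hT, le_rfl⟩
  rwa [gronwallBound_ε0, sub_zero] at key

end Energy

/-! ### The Feynman-Kac evolution equation in `L²`. -/

section Derivatives

variable {𝓧 Ω : Type*} [TopologicalSpace 𝓧] [PolishSpace 𝓧] [MeasurableSpace 𝓧] [BorelSpace 𝓧]
  [mΩ : MeasurableSpace Ω] {ℱ : Filtration ℝ≥0 mΩ} {X : ℝ≥0 → Ω → 𝓧} {P : Kernel 𝓧 Ω}
  {μs : Measure 𝓧} [IsProbabilityMeasure μs] {V : 𝓧 → ℝ} {K : ℝ}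

/-- Convergence in `L¹` on path space passes to `L¹(μs)` because conditioning on the starting point
is a contraction, and then to `L²(μs)` because the quotients are uniformly bounded for `r < 1`. -/
theorem tendsto_eLpNorm_exp_difference_quotient {𝓧 Ω : Type*} [MeasurableSpace 𝓧]
    [MeasurableSpace Ω] {P : Kernel 𝓧 Ω} [IsMarkovKernel P] {μs : Measure 𝓧}
    [IsProbabilityMeasure μs] {I D₀ : Ω → ℝ} {D : ℝ → Ω → ℝ} {M L L₀ : ℝ} (hL : 0 ≤ L)
    (hI : Measurable I)
    (hIM : ∀ ω, |I ω| ≤ M) (hDm : ∀ r, Measurable (D r)) (hDL : ∀ r, 0 < r → ∀ ω, |D r ω| ≤ L * r)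
    (hD₀ : Measurable D₀) (hD₀L : ∀ ω, |D₀ ω| ≤ L₀)
    (hlim : Tendsto (fun r => ∫ ω, |D r ω / r - D₀ ω| ∂(lawFrom P μs)) (𝓝[>] 0) (𝓝 0)) :
    Tendsto (fun r => eLpNorm (fun x => (∫ ω, Real.exp (I ω + D r ω) ∂(P x)
      - ∫ ω, Real.exp (I ω) ∂(P x)) / r - ∫ ω, Real.exp (I ω) * D₀ ω ∂(P x)) 2 μs)
      (𝓝[>] 0) (𝓝 0) := by
  have hone : ∀ᶠ r : ℝ in 𝓝[>] 0, r ∈ Ioo (0 : ℝ) 1 := Ioo_mem_nhdsGT zero_lt_one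
  have hb1 : ∀ r ∈ Ioo (0 : ℝ) 1, ∀ ω, |I ω + D r ω| ≤ M + L := fun r hr ω =>
    (abs_add_le _ _).trans (add_le_add (hIM ω) ((hDL r hr.1 ω).trans
      (mul_le_of_le_one_right hL hr.2.le)))
  have hb2 : ∀ ω, |I ω| ≤ M + L := fun ω => (hIM ω).trans (by linarith)
  have hq : ∀ r ∈ Ioo (0 : ℝ) 1, ∀ ω,
      |(Real.exp (I ω + D r ω) - Real.exp (I ω)) / r| ≤ Real.exp (M + L) * L := fun r hr ω => by
    rw [abs_div, abs_of_pos hr.1, div_le_iff₀ hr.1, mul_assoc]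
    refine (abs_exp_sub_exp_le (hb1 r hr ω) (hb2 ω)).trans ?_
    rw [add_sub_cancel_left]
    exact mul_le_mul_of_nonneg_left (hDL r hr.1 ω) (Real.exp_pos _).le
  have hp : ∀ ω, |Real.exp (I ω) * D₀ ω| ≤ Real.exp (M + L) * L₀ := fun ω => by
    rw [abs_mul]
    exact mul_le_mul (abs_exp_le (hb2 ω)) (hD₀L ω) (abs_nonneg _) (Real.exp_pos _).le
  have hmq : ∀ r, Measurable fun ω => (Real.exp (I ω + D r ω) - Real.exp (I ω)) / r := fun r =>
    ((hI.add (hDm r)).exp.sub hI.exp).div_const r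
  have hmp : Measurable fun ω => Real.exp (I ω) * D₀ ω := hI.exp.mul hD₀
  have heq : ∀ r ∈ Ioo (0 : ℝ) 1, ∀ x, (∫ ω, Real.exp (I ω + D r ω) ∂(P x)
      - ∫ ω, Real.exp (I ω) ∂(P x)) / r =
        ∫ ω, (Real.exp (I ω + D r ω) - Real.exp (I ω)) / r ∂(P x) := fun r hr x => by
    rw [integral_div, integral_sub (f := fun ω => Real.exp (I ω + D r ω))
      (integrable_of_abs_le (hI.add (hDm r)).exp
      fun ω => abs_exp_le (hb1 r hr ω)) (integrable_of_abs_le hI.exp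
      fun ω => abs_exp_le (hIM ω))]
  have hL1 := tendsto_integral_exp_difference_quotient (Q := lawFrom P μs) hIM hDm hDL hD₀ hD₀L
    hlim
  refine tendsto_eLpNorm_two_of_abs_le (M := Real.exp (M + L) * L + Real.exp (M + L) * L₀)
    (fun r => ?_) ?_ ?_
  · exact (((measurable_integral_kernel (hI.add (hDm r)).exp).sub
      (measurable_integral_kernel hI.exp)).div_const r).sub (measurable_integral_kernel hmp)
  · filter_upwards [hone] with r hr x
    rw [heq r hr]
    exact (abs_sub _ _).trans (add_le_add (abs_integral_kernel_le (hq r hr) x)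
      (abs_integral_kernel_le hp x))
  · refine tendsto_of_tendsto_of_tendsto_of_le_of_le' tendsto_const_nhds hL1
      (Eventually.of_forall fun _ => integral_nonneg fun _ => abs_nonneg _) ?_
    filter_upwards [hone] with r hr
    simp_rw [heq r hr]
    exact integral_abs_integral_sub_le (hmq r) hmp (hq r hr) hp

/-- `E^x[exp(∫₀ᵗ V(X_s) ds) V(X_t)]`, the right derivative of the Feynman-Kac functional. -/
noncomputable def feynmanKacDeriv {𝓧 Ω : Type*} [MeasurableSpace 𝓧]
    [MeasurableSpace Ω] (X : ℝ≥0 → Ω → 𝓧) (P : Kernel 𝓧 Ω) (V : 𝓧 → ℝ) (t : ℝ) (x : 𝓧) : ℝ :=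
  ∫ ω, Real.exp (∫ s in 0..t, V (X s.toNNReal ω)) * V (X t.toNNReal ω) ∂(P x)

namespace IsMarkovFamily

theorem measurable_feynmanKacDeriv (hX : IsMarkovFamily ℱ X P) (hinv : IsInvariant X P μs)
    (hV : Measurable V) (hK : ∀ x, |V x| ≤ K) (t : ℝ) : Measurable (feynmanKacDeriv X P V t) :=
  have := hX.isMarkovKernel
  measurable_integral_kernel ((hX.measurable_exp_integral hinv hV hK 0 t).mul
    (hV.comp (hX.measurable _)))

theorem abs_exp_integral_mul_le (hX : IsMarkovFamily ℱ X P) (hinv : IsInvariant X P μs)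
    (hV : Measurable V) (hK : ∀ x, |V x| ≤ K) (t : ℝ) (a : ℝ≥0) (ω : Ω) :
    |Real.exp (∫ s in 0..t, V (X s.toNNReal ω)) * V (X a ω)| ≤ Real.exp (K * |t|) * K := by
  have h := hX.abs_exp_integral_le hinv hV hK 0 t ω
  rw [sub_zero] at h
  rw [abs_mul]
  exact mul_le_mul h (hK _) (abs_nonneg _) (Real.exp_pos _).le

theorem abs_feynmanKacDeriv_le (hX : IsMarkovFamily ℱ X P) (hinv : IsInvariant X P μs)
    (hV : Measurable V) (hK : ∀ x, |V x| ≤ K) (t : ℝ) (x : 𝓧) :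
    |feynmanKacDeriv X P V t x| ≤ Real.exp (K * |t|) * K :=
  have := hX.isMarkovKernel
  abs_integral_kernel_le (hX.abs_exp_integral_mul_le hinv hV hK t _) x

theorem tendsto_feynmanKac_difference_quotient (hX : IsMarkovFamily ℱ X P)
    (hinv : IsInvariant X P μs) (hV : Measurable V) (hK : ∀ x, |V x| ≤ K) (t : ℝ) :
    Tendsto (fun r => eLpNorm (fun x => (feynmanKac X P V (t + r) x - feynmanKac X P V t x) / r
      - feynmanKacDeriv X P V t x) 2 μs) (𝓝[>] 0) (𝓝 0) := by
  have := hX.isMarkovKernel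
  have hv := hX.isL1RightCts hinv hV hK
  obtain ⟨x₀⟩ : Nonempty 𝓧 := nonempty_of_isProbabilityMeasure μs
  have hK0 : 0 ≤ K := (abs_nonneg _).trans (hK x₀)
  have h := tendsto_eLpNorm_exp_difference_quotient (P := P) (μs := μs) (L := K) (L₀ := K)
    (I := fun ω => ∫ s in 0..t, V (X s.toNNReal ω))
    (D := fun r ω => ∫ s in t..t + r, V (X s.toNNReal ω)) (D₀ := fun ω => V (X t.toNNReal ω))
    hK0 (hv.measurable_intervalIntegral 0 t) (fun ω => hv.abs_intervalIntegral_le ω 0 t)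
    (fun r => hv.measurable_intervalIntegral _ _) (fun r hr ω => by
      simpa [abs_of_pos hr] using hv.abs_intervalIntegral_le ω t (t + r))
    (hv.measurable_apply t) (hv.bound t) (hv.tendsto_average t)
  refine h.congr fun r => ?_
  congr 1
  ext x
  simp only [feynmanKac, feynmanKacDeriv]
  simp_rw [intervalIntegral.integral_add_adjacent_intervals (hv.intervalIntegrable _ 0 t)
    (hv.intervalIntegrable _ t (t + _))]

/-- Shifting the window from `[0, t]` to `[r, r + t]` gains `∫_t^{t+r}` and loses `∫_0^r`, so the
exponent has derivative `V(X_t) - V(X_0)` at `r = 0`. -/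
theorem tendsto_feynmanKac_generator (hX : IsMarkovFamily ℱ X P)
    (hinv : IsInvariant X P μs) (hV : Measurable V) (hK : ∀ x, |V x| ≤ K) (t : ℝ) :
    Tendsto (fun r : ℝ => eLpNorm (fun x =>
      (∫ ω, Real.exp (∫ s in r..r + t, V (X s.toNNReal ω)) ∂(P x) - feynmanKac X P V t x) / r
      - (feynmanKacDeriv X P V t x - V x * feynmanKac X P V t x)) 2 μs) (𝓝[>] 0) (𝓝 0) := by
  have := hX.isMarkovKernel
  have hv := hX.isL1RightCts hinv hV hK
  obtain ⟨x₀⟩ : Nonempty 𝓧 := nonempty_of_isProbabilityMeasure μs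
  have hK0 : 0 ≤ K := (abs_nonneg _).trans (hK x₀)
  have hb : ∀ (a r : ℝ), 0 < r → ∀ ω, |∫ s in a..a + r, V (X s.toNNReal ω)| ≤ K * r :=
    fun a r hr ω => by simpa [abs_of_pos hr] using hv.abs_intervalIntegral_le ω a (a + r)
  have hint : ∀ a r : ℝ, 0 < r → Integrable (fun ω =>
      |(∫ s in a..a + r, V (X s.toNNReal ω)) / r - V (X a.toNNReal ω)|) (lawFrom P μs) :=
    fun a r hr => integrable_of_abs_le (K := K + K)
      (((hv.measurable_intervalIntegral a (a + r)).div_const r).sub (hv.measurable_apply a)).abs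
      fun ω => by
        rw [abs_abs]
        refine (abs_sub _ _).trans (add_le_add ?_ (hK _))
        rw [abs_div, abs_of_pos hr, div_le_iff₀ hr]
        exact hb a r hr ω
  have hlim : Tendsto (fun r : ℝ => ∫ ω, |((∫ s in t..t + r, V (X s.toNNReal ω))
      - ∫ s in 0..0 + r, V (X s.toNNReal ω)) / r
      - (V (X t.toNNReal ω) - V (X (0 : ℝ).toNNReal ω))| ∂(lawFrom P μs)) (𝓝[>] 0) (𝓝 0) := by
    have h0 := (hv.tendsto_average t).add (hv.tendsto_average 0)
    rw [add_zero] at h0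
    refine tendsto_of_tendsto_of_tendsto_of_le_of_le' tendsto_const_nhds h0
      (Eventually.of_forall fun _ => integral_nonneg fun _ => abs_nonneg _) ?_
    filter_upwards [self_mem_nhdsWithin] with r (hr : 0 < r)
    rw [← integral_add (hint t r hr) (hint 0 r hr)]
    refine integral_mono_of_nonneg (Eventually.of_forall fun _ => abs_nonneg _)
      ((hint t r hr).add (hint 0 r hr)) (Eventually.of_forall fun ω => ?_)
    simp only
    rw [sub_div, sub_sub_sub_comm]
    exact abs_sub _ _
  have h := tendsto_eLpNorm_exp_difference_quotient (P := P) (μs := μs) (L := K + K) (L₀ := K + K)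
    (I := fun ω => ∫ s in 0..t, V (X s.toNNReal ω))
    (D := fun r ω => (∫ s in t..t + r, V (X s.toNNReal ω)) - ∫ s in 0..0 + r, V (X s.toNNReal ω))
    (D₀ := fun ω => V (X t.toNNReal ω) - V (X (0 : ℝ).toNNReal ω))
    (add_nonneg hK0 hK0) (hv.measurable_intervalIntegral 0 t)
    (fun ω => hv.abs_intervalIntegral_le ω 0 t)
    (fun r => (hv.measurable_intervalIntegral _ _).sub (hv.measurable_intervalIntegral _ _))
    (fun r hr ω => by
      rw [add_mul]
      exact (abs_sub _ _).trans (add_le_add (hb t r hr ω) (hb 0 r hr ω)))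
    ((hv.measurable_apply t).sub (hv.measurable_apply 0))
    (fun ω => (abs_sub _ _).trans (add_le_add (hK _) (hK _))) hlim
  refine h.congr fun r => ?_
  congr 1
  ext x
  have e1 : ∀ ω, (∫ s in 0..t, V (X s.toNNReal ω)) + ((∫ s in t..t + r, V (X s.toNNReal ω))
      - ∫ s in 0..0 + r, V (X s.toNNReal ω)) = ∫ s in r..r + t, V (X s.toNNReal ω) := fun ω => by
    rw [zero_add, ← add_sub_assoc, intervalIntegral.integral_add_adjacent_intervals
      (hv.intervalIntegrable _ 0 t) (hv.intervalIntegrable _ t (t + r)),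
      ← intervalIntegral.integral_add_adjacent_intervals
      (hv.intervalIntegrable _ 0 r) (hv.intervalIntegrable _ r (t + r)), add_sub_cancel_left,
      add_comm t r]
  have e2 : ∫ ω, Real.exp (∫ s in 0..t, V (X s.toNNReal ω)) *
      (V (X t.toNNReal ω) - V (X (0 : ℝ).toNNReal ω)) ∂(P x)
      = feynmanKacDeriv X P V t x - V x * feynmanKac X P V t x := by
    have hm := hX.measurable_exp_integral hinv hV hK 0 t
    simp_rw [mul_sub]
    rw [integral_sub
      (f := fun ω => Real.exp (∫ s in 0..t, V (X s.toNNReal ω)) * V (X t.toNNReal ω))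
      (g := fun ω => Real.exp (∫ s in 0..t, V (X s.toNNReal ω)) * V (X (0 : ℝ).toNNReal ω))
      (integrable_of_abs_le (hm.mul (hv.measurable_apply t))
      (hX.abs_exp_integral_mul_le hinv hV hK t _)) (integrable_of_abs_le
      (hm.mul (hv.measurable_apply 0)) (hX.abs_exp_integral_mul_le hinv hV hK t _)),
      feynmanKac, ← integral_const_mul]
    congr 1
    refine integral_congr_ae ?_
    -- Under `P x` the path starts at `x`, which turns `V(X_0)` into the constant `V x`.
    filter_upwards [hX.initial_mem x (measurableSet_singleton x)] with ω hω
    have hx0 : X 0 ω = x := by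
      by_contra hne
      simp [hne] at hω
    simp only [Real.toNNReal_zero, hx0]
    ring
  rw [e2]
  simp_rw [e1]
  rfl

/-- Invariance is what makes the transition operators well defined on `μs`-classes: a `μs`-null set
is almost surely avoided at time `t`. -/
theorem transition_congr_ae {𝓧 : Type*} [TopologicalSpace 𝓧] [MeasurableSpace 𝓧]
    {X : ℝ≥0 → Ω → 𝓧} {P : Kernel 𝓧 Ω} {μs : Measure 𝓧} (hX : IsMarkovFamily ℱ X P)
    (hinv : IsInvariant X P μs) (t : ℝ≥0) {g g' : 𝓧 → ℝ} (h : g =ᵐ[μs] g') :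
    transition X P t g =ᵐ[μs] transition X P t g' := by
  have h1 : ∀ᵐ ω ∂(lawFrom P μs), g (X t ω) = g' (X t ω) :=
    ae_of_ae_map (hX.measurable t).aemeasurable (p := fun y => g y = g' y) (by rwa [hinv t])
  have h2 := Measure.ae_ae_of_ae_bind P.aemeasurable h1
  filter_upwards [h2] with x hx
  exact integral_congr_ae hx

/-- The Feynman-Kac functional as a curve in `L²`. -/
noncomputable def feynmanKacLp (hX : IsMarkovFamily ℱ X P) (hinv : IsInvariant X P μs)
    (hV : Measurable V) (hK : ∀ x, |V x| ≤ K) (t : ℝ) : Lp ℝ 2 μs :=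
  boundedLp μs (hX.measurable_feynmanKac hinv hV hK t) (hX.abs_feynmanKac_le hinv hV hK t)

/-- The right derivative of the Feynman-Kac functional as a curve in `L²`. -/
noncomputable def feynmanKacDerivLp (hX : IsMarkovFamily ℱ X P) (hinv : IsInvariant X P μs)
    (hV : Measurable V) (hK : ∀ x, |V x| ≤ K) (t : ℝ) : Lp ℝ 2 μs :=
  boundedLp μs (hX.measurable_feynmanKacDeriv hinv hV hK t)
    (hX.abs_feynmanKacDeriv_le hinv hV hK t)

/-- Grönwall with right derivatives also needs continuity. The exponent is Lipschitz in time
uniformly over paths, so the curve is Lipschitz in supremum norm, hence in `L²`. -/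
theorem continuousOn_feynmanKacLp (hX : IsMarkovFamily ℱ X P) (hinv : IsInvariant X P μs)
    (hV : Measurable V) (hK : ∀ x, |V x| ≤ K) (T : ℝ) :
    ContinuousOn (hX.feynmanKacLp hinv hV hK) (Icc 0 T) := by
  have := hX.isMarkovKernel
  have hv := hX.isL1RightCts hinv hV hK
  obtain ⟨x₀⟩ : Nonempty 𝓧 := nonempty_of_isProbabilityMeasure μs
  have hK0 : 0 ≤ K := (abs_nonneg _).trans (hK x₀)
  have hC : 0 ≤ Real.exp (K * T) * K := mul_nonneg (Real.exp_pos _).le hK0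
  refine LipschitzOnWith.continuousOn (K := (Real.exp (K * T) * K).toNNReal)
    (LipschitzOnWith.of_dist_le_mul fun a ha b hb => ?_)
  rw [dist_eq_norm, Real.dist_eq, Real.coe_toNNReal _ hC]
  refine norm_boundedLp_sub_le _ _ _ _ (mul_nonneg hC (abs_nonneg _)) fun x => ?_
  have hbd : ∀ c ∈ Icc 0 T, ∀ ω, |∫ s in 0..c, V (X s.toNNReal ω)| ≤ K * T := fun c hc ω => by
    refine (hv.abs_intervalIntegral_le ω 0 c).trans ?_
    rw [sub_zero, abs_of_nonneg hc.1]
    exact mul_le_mul_of_nonneg_left hc.2 hK0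
  simp only [feynmanKac]
  rw [← integral_sub (integrable_of_abs_le (hX.measurable_exp_integral hinv hV hK 0 a)
    fun ω => abs_exp_le (hbd a ha ω)) (integrable_of_abs_le
    (hX.measurable_exp_integral hinv hV hK 0 b) fun ω => abs_exp_le (hbd b hb ω))]
  refine abs_integral_kernel_le (fun ω => (abs_exp_sub_exp_le (hbd a ha ω) (hbd b hb ω)).trans ?_) x
  rw [mul_assoc]
  refine mul_le_mul_of_nonneg_left ?_ (Real.exp_pos _).le
  rw [intervalIntegral.integral_interval_sub_left (hv.intervalIntegrable ω 0 a)
    (hv.intervalIntegrable ω 0 b)]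
  exact hv.abs_intervalIntegral_le ω b a

theorem hasDerivWithinAt_feynmanKacLp (hX : IsMarkovFamily ℱ X P) (hinv : IsInvariant X P μs)
    (hV : Measurable V) (hK : ∀ x, |V x| ≤ K) (t : ℝ) :
    HasDerivWithinAt (hX.feynmanKacLp hinv hV hK) (hX.feynmanKacDerivLp hinv hV hK t)
      (Ici t) t := by
  rw [← hasDerivWithinAt_Ioi_iff_Ici, hasDerivWithinAt_iff_tendsto_slope' self_notMem_Ioi,
    tendsto_iff_norm_sub_tendsto_zero]
  have hsub : Tendsto (fun s : ℝ => s - t) (𝓝[>] t) (𝓝[>] 0) := by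
    refine tendsto_nhdsWithin_iff.2 ⟨?_, ?_⟩
    · have : Tendsto (fun s : ℝ => s - t) (𝓝 t) (𝓝 (t - t)) := tendsto_id.sub_const t
      rw [sub_self] at this
      exact this.mono_left nhdsWithin_le_nhds
    · filter_upwards [self_mem_nhdsWithin] with s (hs : t < s)
      exact sub_pos.2 hs
  have h1 := (ENNReal.tendsto_toReal ENNReal.zero_ne_top).comp
    ((hX.tendsto_feynmanKac_difference_quotient hinv hV hK t).comp hsub)
  rw [ENNReal.toReal_zero] at h1
  refine h1.congr fun s => ?_
  simp only [Function.comp_apply, add_sub_cancel]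
  rw [Lp.norm_def]
  congr 1
  refine eLpNorm_congr_ae ?_
  rw [slope_def_module]
  filter_upwards [Lp.coeFn_sub ((s - t)⁻¹ • (hX.feynmanKacLp hinv hV hK s
      - hX.feynmanKacLp hinv hV hK t)) (hX.feynmanKacDerivLp hinv hV hK t),
    Lp.coeFn_smul (s - t)⁻¹ (hX.feynmanKacLp hinv hV hK s - hX.feynmanKacLp hinv hV hK t),
    Lp.coeFn_sub (hX.feynmanKacLp hinv hV hK s) (hX.feynmanKacLp hinv hV hK t),
    coeFn_boundedLp (μ := μs) (hX.measurable_feynmanKac hinv hV hK s)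
      (hX.abs_feynmanKac_le hinv hV hK s),
    coeFn_boundedLp (μ := μs) (hX.measurable_feynmanKac hinv hV hK t)
      (hX.abs_feynmanKac_le hinv hV hK t),
    coeFn_boundedLp (μ := μs) (hX.measurable_feynmanKacDeriv hinv hV hK t)
      (hX.abs_feynmanKacDeriv_le hinv hV hK t)] with x h1 h2 h3 h4 h5 h6
  rw [h1, Pi.sub_apply, h2, Pi.smul_apply, h3, Pi.sub_apply]
  simp only [feynmanKacLp, feynmanKacDerivLp]
  rw [h4, h5, h6, smul_eq_mul, div_eq_inv_mul]

/-- By the Markov property `𝒫_r u_t` is the functional over the shifted window, whose difference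
quotient is already known. This is the equation `A u = u' - V u`, with membership in `D(A)`
included. -/
theorem generatorGraph_feynmanKacLp (hX : IsMarkovFamily ℱ X P) (hinv : IsInvariant X P μs)
    (hV : Measurable V) (hK : ∀ x, |V x| ≤ K) {t : ℝ} (ht : 0 ≤ t) {M : Lp ℝ 2 μs}
    (hM : M =ᵐ[μs] fun x => V x * feynmanKac X P V t x) :
    GeneratorGraph X P μs (hX.feynmanKacLp hinv hV hK t)
      (hX.feynmanKacDerivLp hinv hV hK t - M) := by
  have hcoe : Tendsto (fun r : ℝ≥0 => (r : ℝ)) (𝓝[>] 0) (𝓝[>] 0) := by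
    refine tendsto_nhdsWithin_iff.2 ⟨?_, ?_⟩
    · exact (NNReal.continuous_coe.tendsto 0).mono_left nhdsWithin_le_nhds
    · filter_upwards [self_mem_nhdsWithin] with s hs
      exact NNReal.coe_pos.2 hs
  refine ((hX.tendsto_feynmanKac_generator hinv hV hK t).comp hcoe).congr fun r => ?_
  simp only [Function.comp_apply]
  refine eLpNorm_congr_ae ?_
  have hU := coeFn_boundedLp (μ := μs) (hX.measurable_feynmanKac hinv hV hK t)
    (hX.abs_feynmanKac_le hinv hV hK t)
  filter_upwards [hU, hM, hX.transition_congr_ae hinv r hU,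
    hX.transition_feynmanKac hinv hV hK r ht,
    Lp.coeFn_sub (hX.feynmanKacDerivLp hinv hV hK t) M,
    coeFn_boundedLp (μ := μs) (hX.measurable_feynmanKacDeriv hinv hV hK t)
      (hX.abs_feynmanKacDeriv_le hinv hV hK t)] with x h1 h2 h3 h4 h5 h6
  rw [h5, Pi.sub_apply, h2]
  simp only [feynmanKacLp, feynmanKacDerivLp]
  rw [h3, h4, h6, h1]

end IsMarkovFamily

end Derivatives

/-! ### The modified inner product and the perturbed generator. -/

section Forms

variable {𝓧 : Type*} [MeasurableSpace 𝓧] {μs : Measure 𝓧}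
  {B : LinearMap.BilinForm ℝ (Lp ℝ 2 μs)}

namespace IsInnerProduct

theorem nonneg (hB : IsInnerProduct B) (g : Lp ℝ 2 μs) : 0 ≤ B g g := by
  rcases eq_or_ne g 0 with rfl | h
  · simp
  · exact (hB.pos g h).le

theorem sharpNorm_sq (hB : IsInnerProduct B) (g : Lp ℝ 2 μs) : sharpNorm B g ^ 2 = B g g :=
  Real.sq_sqrt (hB.nonneg g)

theorem abs_apply_le (hB : IsInnerProduct B) (g h : Lp ℝ 2 μs) :
    |B g h| ≤ sharpNorm B g * sharpNorm B h := by
  have h1 : (B g h) ^ 2 ≤ B g g * B h h :=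
    LinearMap.BilinForm.apply_sq_le_of_symm B hB.nonneg ⟨fun x y => by simpa using hB.symm x y⟩ g h
  rw [sharpNorm, sharpNorm, ← Real.sqrt_mul (hB.nonneg g), ← Real.sqrt_sq_eq_abs]
  exact Real.sqrt_le_sqrt h1

theorem exists_continuousLinearMap (hB : IsInnerProduct B) {C : ℝ}
    (hup : ∀ g, sharpNorm B g ≤ C * ‖g‖) :
    ∃ Bc : Lp ℝ 2 μs →L[ℝ] Lp ℝ 2 μs →L[ℝ] ℝ, ∀ g h, Bc g h = B g h := by
  refine ⟨LinearMap.mkContinuous₂ B (C * C) fun g h => ?_, fun g h => rfl⟩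
  calc ‖B g h‖ ≤ sharpNorm B g * sharpNorm B h := hB.abs_apply_le g h
    _ ≤ (C * ‖g‖) * (C * ‖h‖) :=
      mul_le_mul (hup g) (hup h) (Real.sqrt_nonneg _) ((Real.sqrt_nonneg _).trans (hup g))
    _ = (C * C) * ‖g‖ * ‖h‖ := by ring

/-- The numerical range of a bounded operator bounds its quadratic form. -/
theorem apply_self_le (hB : IsInnerProduct B) {c C : ℝ} (hc : 0 < c)
    (hlow : ∀ g, c * ‖g‖ ≤ sharpNorm B g) (hup : ∀ g, sharpNorm B g ≤ C * ‖g‖) (hC : 0 < C)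
    (M : Lp ℝ 2 μs →L[ℝ] Lp ℝ 2 μs) (h : Lp ℝ 2 μs) :
    B (M h) h ≤ max 0 (sSup {s : ℝ | ∃ g : Lp ℝ 2 μs, sharpNorm B g = 1 ∧ s = B (M g) g})
      * B h h := by
  rcases eq_or_ne h 0 with rfl | hne
  · simp
  have hbdd : BddAbove {s : ℝ | ∃ g : Lp ℝ 2 μs, sharpNorm B g = 1 ∧ s = B (M g) g} := by
    refine ⟨C * (‖M‖ * (1 / c)), ?_⟩
    rintro s ⟨g, hg, rfl⟩
    have hgc : ‖g‖ ≤ 1 / c := by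
      rw [le_div_iff₀ hc, mul_comm, ← hg]; exact hlow g
    calc B (M g) g ≤ sharpNorm B (M g) * sharpNorm B g :=
          (le_abs_self _).trans (hB.abs_apply_le _ _)
      _ = sharpNorm B (M g) := by rw [hg, mul_one]
      _ ≤ C * ‖M g‖ := hup _
      _ ≤ C * (‖M‖ * (1 / c)) := by
        refine mul_le_mul_of_nonneg_left ((M.le_opNorm g).trans ?_) hC.le
        exact mul_le_mul_of_nonneg_left hgc (norm_nonneg _)
  have hpos : 0 < B h h := hB.pos h hne
  set r := sharpNorm B h with hr
  have hrr : r ^ 2 = B h h := hB.sharpNorm_sq h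
  have hr0 : 0 < r := Real.sqrt_pos.2 hpos
  have hmem : B (M (r⁻¹ • h)) (r⁻¹ • h) ∈
      {s : ℝ | ∃ g : Lp ℝ 2 μs, sharpNorm B g = 1 ∧ s = B (M g) g} := by
    refine ⟨r⁻¹ • h, ?_, rfl⟩
    simp only [sharpNorm, map_smul, LinearMap.smul_apply, smul_eq_mul]
    rw [← hrr]
    rw [show r⁻¹ * (r⁻¹ * r ^ 2) = 1 by field_simp, Real.sqrt_one]
  have h1 := (le_csSup hbdd hmem).trans (le_max_right 0 _)
  simp only [map_smul, LinearMap.smul_apply, smul_eq_mul] at h1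
  rw [← hrr]
  calc B (M h) h = (r⁻¹ * (r⁻¹ * B (M h) h)) * r ^ 2 := by field_simp
    _ ≤ _ := mul_le_mul_of_nonneg_right h1 (sq_nonneg _)

end IsInnerProduct

theorem coeFn_mulOp {φ : Lp ℝ ∞ μs} {V : 𝓧 → ℝ} (hφ : φ =ᵐ[μs] V) (g : Lp ℝ 2 μs) :
    mulOp φ g =ᵐ[μs] fun x => V x * g x := by
  have h := ContinuousLinearMap.coeFn_holder (r := 2) (ContinuousLinearMap.mul ℝ ℝ) φ g
  filter_upwards [h, hφ] with x h1 h2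
  change (ContinuousLinearMap.holder 2 (ContinuousLinearMap.mul ℝ ℝ) φ g : 𝓧 → ℝ) x = _
  rw [h1, h2]
  rfl

theorem inner_const_one [IsProbabilityMeasure μs] (g : Lp ℝ 2 μs) :
    inner ℝ g (Lp.const 2 μs (1 : ℝ)) = ∫ x, g x ∂μs := by
  rw [L2.inner_def]
  refine integral_congr_ae ?_
  filter_upwards [Lp.coeFn_const (p := 2) (μ := μs) (1 : ℝ)] with x hx
  rw [hx]
  simp

/-- With `q = 1 - lam α b`, the right side minus the left is the square `(q x - lam α y a)² / (α
q)`. In the application `x = ‖h‖_#`, `y = ‖½ (M + M†) 1‖_#`, and `a` is the modulus of the mean. -/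
theorem neg_mul_sq_add_le {α lam b a x y : ℝ} (hα : 0 < α) (hb : lam * (α * b) < 1) :
    -(x ^ 2 / α) + lam * (b * x ^ 2) + 2 * (lam * a * y * x) ≤
      lam ^ 2 * (2 * α * y ^ 2) / (2 * (1 - lam * (α * b))) * a ^ 2 := by
  obtain ⟨q, hq⟩ : ∃ q, q = 1 - lam * (α * b) := ⟨_, rfl⟩
  have hq0 : 0 < q := by linarith
  have hlb : lam * (b * x ^ 2) = (1 - q) * x ^ 2 / α := by rw [hq]; field_simp; ring
  have h : lam ^ 2 * (2 * α * y ^ 2) / (2 * q) * a ^ 2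
      - (-(x ^ 2 / α) + (1 - q) * x ^ 2 / α + 2 * (lam * a * y * x))
      = (q * x - lam * α * y * a) ^ 2 / (α * q) := by
    field_simp; ring
  have h2 : 0 ≤ (q * x - lam * α * y * a) ^ 2 / (α * q) := by positivity
  rw [← hq, hlb]
  linarith

/-- The quadratic form of a perturbed hypocoercive generator. -/
theorem form_generator_add_mulOp_le [IsProbabilityMeasure μs] (hB : IsInnerProduct B)
    {c C : ℝ} (hc : 0 < c) (hcC : c ≤ C)
    (hlow : ∀ g, c * ‖g‖ ≤ sharpNorm B g) (hup : ∀ g, sharpNorm B g ≤ C * ‖g‖)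
    (hone : ∀ g, B g (Lp.const 2 μs (1 : ℝ)) = inner ℝ g (Lp.const 2 μs (1 : ℝ)))
    {α : ℝ} (hα : 0 < α) {φ : Lp ℝ ∞ μs} {V : 𝓧 → ℝ} (hφ : φ =ᵐ[μs] V) (hV0 : ∫ x, V x ∂μs = 0)
    {lam : ℝ} (hlam : 0 ≤ lam) (hlb : lam * bConst B α φ < 1) {g Ag : Lp ℝ 2 μs}
    (hA0 : ∫ x, Ag x ∂μs = 0)
    (hpoin : sharpNorm B (g - Lp.const 2 μs (∫ x, g x ∂μs)) ^ 2 ≤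
      α * B (-Ag) (g - Lp.const 2 μs (∫ x, g x ∂μs))) :
    B (Ag + lam • mulOp φ g) g ≤
      lam ^ 2 * vConst B α φ / (2 * (1 - lam * bConst B α φ)) * B g g := by
  set one := Lp.const 2 μs (1 : ℝ) with hone_def
  set a := ∫ x, g x ∂μs with ha
  set h := g - Lp.const 2 μs a with hh
  have hca : Lp.const 2 μs a = a • one := by
    have := (Lp.constL 2 μs ℝ).map_smul a (1 : ℝ)
    rwa [smul_eq_mul, mul_one] at this
  have hB1 : ∀ k : Lp ℝ 2 μs, B k one = ∫ x, k x ∂μs := fun k => by rw [hone, inner_const_one]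
  have h11 : B one one = 1 := by
    rw [hB1, integral_congr_ae (Lp.coeFn_const (p := 2) (μ := μs) (1 : ℝ))]
    simp
  have hg : g = h + a • one := by rw [hh, hca]; abel
  have hh1 : B h one = 0 := by
    rw [hh, hca, map_sub, LinearMap.sub_apply, map_smul, LinearMap.smul_apply, h11, hB1, ← ha]
    simp
  have hM11 : B (mulOp φ one) one = 0 := by
    rw [hB1, ← hV0]
    refine integral_congr_ae ?_
    filter_upwards [coeFn_mulOp hφ one, Lp.coeFn_const (p := 2) (μ := μs) (1 : ℝ)] with x h1 h2
    rw [h1, h2]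
    simp
  have hgg : B g g = B h h + a ^ 2 := by
    rw [hg]
    simp only [map_add, map_smul, LinearMap.add_apply, LinearMap.smul_apply, smul_eq_mul]
    rw [hB.symm one h, hh1, h11]
    ring
  -- As `Ag` has mean zero it pairs to `0` with constants, leaving the pairing with `h` controlled
  -- by the Poincaré inequality.
  have hAg : B Ag g ≤ -(sharpNorm B h ^ 2 / α) := by
    have h1 : B Ag g = B Ag h := by
      conv_lhs => rw [hg]
      simp only [map_add, map_smul, smul_eq_mul]
      rw [hB1 Ag, hA0]
      ring
    rw [map_neg, LinearMap.neg_apply] at hpoin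
    rw [h1, le_neg, div_le_iff₀ hα]
    linarith
  set w := (1 / 2 : ℝ) • (mulOp φ + sharpAdjoint B (mulOp φ)) one with hw
  have hMg : B (mulOp φ g) g = B (mulOp φ h) h + 2 * (a * B w h) := by
    have hspec := sharpAdjoint_spec hB hc hlow hup (mulOp φ)
    have hw2 : 2 * B w h = B (mulOp φ one) h + B (mulOp φ h) one := by
      rw [hw, map_smul, LinearMap.smul_apply, _root_.add_apply, map_add,
        LinearMap.add_apply, hspec h one, hB.symm (sharpAdjoint B (mulOp φ) one) h, smul_eq_mul]
      ring
    have : B (mulOp φ g) g = B (mulOp φ h) h + a * (B (mulOp φ one) h + B (mulOp φ h) one)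
        + a ^ 2 * B (mulOp φ one) one := by
      rw [hg]
      simp only [map_add, map_smul, LinearMap.add_apply, LinearMap.smul_apply, smul_eq_mul]
      ring
    rw [this, hM11, ← hw2]
    ring
  set b := max 0 (sSup {s : ℝ | ∃ g : Lp ℝ 2 μs, sharpNorm B g = 1 ∧ s = B (mulOp φ g) g})
    with hb
  have hbC : bConst B α φ = α * b := rfl
  have hvC : vConst B α φ = 2 * α * sharpNorm B w ^ 2 := rfl
  have hMh : B (mulOp φ h) h ≤ b * B h h :=
    hB.apply_self_le hc hlow hup (hc.trans_le hcC) (mulOp φ) h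
  have haw : a * B w h ≤ |a| * sharpNorm B w * sharpNorm B h := by
    rw [mul_assoc]
    refine (le_abs_self _).trans ?_
    rw [abs_mul]
    exact mul_le_mul_of_nonneg_left (hB.abs_apply_le w h) (abs_nonneg _)
  rw [hbC] at hlb
  have hkey := neg_mul_sq_add_le (a := |a|) (x := sharpNorm B h) (y := sharpNorm B w) hα hlb
  rw [sq_abs] at hkey
  -- Completing the square yields the bound `Λ a²`; since `Λ ≥ 0`, it may be enlarged to `Λ (B h h +
  -- a²) = Λ B g g`.
  have hΛ : 0 ≤ lam ^ 2 * vConst B α φ / (2 * (1 - lam * bConst B α φ)) := by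
    rw [hbC, hvC]
    have : 0 < 1 - lam * (α * b) := by linarith
    positivity
  rw [map_add, LinearMap.add_apply, map_smul, LinearMap.smul_apply, smul_eq_mul, hMg, hgg, mul_add]
  have hx := hB.sharpNorm_sq h
  have h3 := mul_nonneg hΛ (hB.nonneg h)
  have h4 : lam * (B (mulOp φ h) h + 2 * (a * B w h)) ≤
      lam * (b * sharpNorm B h ^ 2 + 2 * (|a| * sharpNorm B w * sharpNorm B h)) := by
    rw [hx]
    exact mul_le_mul_of_nonneg_left (by linarith) hlam
  rw [← hbC, ← hvC] at hkey
  linarith [hkey, h4, hAg, h3]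

/-- The numerical range of multiplication by a nonzero centred function meets `(0, ∞)`. -/
theorem bConst_pos [IsProbabilityMeasure μs] (hB : IsInnerProduct B)
    {c C : ℝ} (hc : 0 < c) (hcC : c ≤ C)
    (hlow : ∀ g, c * ‖g‖ ≤ sharpNorm B g) (hup : ∀ g, sharpNorm B g ≤ C * ‖g‖)
    {α : ℝ} (hα : 0 < α) {φ : Lp ℝ ∞ μs} {V : 𝓧 → ℝ} (hφ : φ =ᵐ[μs] V) (hV : Measurable V)
    (hVi : Integrable V μs) (hV0 : ∫ x, V x ∂μs = 0) (hne : ¬ V =ᵐ[μs] 0) :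
    0 < bConst B α φ := by
  have hC : 0 < C := hc.trans_le hcC
  set b := max 0 (sSup {s : ℝ | ∃ g : Lp ℝ 2 μs, sharpNorm B g = 1 ∧ s = B (mulOp φ g) g})
    with hb
  have hb0 : 0 ≤ b := le_max_left _ _
  refine mul_pos hα (hb0.lt_of_ne' fun hbz => hne ?_)
  -- If the constant vanishes, multiplication by `V` is dissipative for `B`. This will force `V ≤
  -- 0`, although `B` need not make multiplication symmetric.
  have hdiss : ∀ h, B (mulOp φ h) h ≤ 0 := fun h => by
    have := hB.apply_self_le hc hlow hup hC (mulOp φ) h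
    rwa [← hb, hbz, zero_mul] at this
  -- Where `V` is close to `s > 0`, multiplication by `V / s` is close to the identity. The
  -- half-width `s c / (2 C)` makes the discrepancy at most `c / (2 C)`, small enough to survive
  -- both norm comparisons.
  have hloc : ∀ s : ℝ, 0 < s → μs (V ⁻¹' Ioo (s - s * c / (2 * C)) (s + s * c / (2 * C))) = 0 := by
    intro s hs
    set A := V ⁻¹' Ioo (s - s * c / (2 * C)) (s + s * c / (2 * C)) with hA
    have hAm : MeasurableSet A := hV measurableSet_Ioo
    set g : Lp ℝ 2 μs := indicatorConstLp 2 hAm (measure_ne_top μs A) (1 : ℝ) with hg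
    -- Dissipativity gives `B g g ≤ B (g - s⁻¹ M g) g`; then Cauchy-Schwarz.
    have h1 : sharpNorm B g ≤ sharpNorm B (g - s⁻¹ • mulOp φ g) := by
      have h2 : sharpNorm B g ^ 2 ≤ sharpNorm B (g - s⁻¹ • mulOp φ g) * sharpNorm B g := by
        rw [hB.sharpNorm_sq]
        refine le_trans ?_ ((le_abs_self _).trans (hB.abs_apply_le _ _))
        rw [map_sub, LinearMap.sub_apply, map_smul, LinearMap.smul_apply, smul_eq_mul]
        have := mul_nonpos_of_nonneg_of_nonpos (inv_pos.2 hs).le (hdiss g)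
        linarith
      by_contra hlt
      push Not at hlt
      have h3 : 0 < sharpNorm B g := (Real.sqrt_nonneg _).trans_lt hlt
      nlinarith
    have h2 : ‖g - s⁻¹ • mulOp φ g‖ ≤ c / (2 * C) * ‖g‖ := by
      refine Lp.norm_le_mul_norm_of_ae_le_mul ?_
      filter_upwards [Lp.coeFn_sub g (s⁻¹ • mulOp φ g), Lp.coeFn_smul s⁻¹ (mulOp φ g),
        coeFn_mulOp hφ g, indicatorConstLp_coeFn (p := 2) (hs := hAm)
          (hμs := measure_ne_top μs A) (c := (1 : ℝ))] with x e1 e2 e3 e4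
      rw [e1, Pi.sub_apply, e2, Pi.smul_apply, e3, e4]
      by_cases hx : x ∈ A
      · have hx' : |V x - s| ≤ s * c / (2 * C) := by
          have := hx
          rw [hA, mem_preimage, mem_Ioo] at this
          rw [abs_le]; constructor <;> linarith [this.1, this.2]
        simp only [indicator_of_mem hx, smul_eq_mul, mul_one, norm_one, Real.norm_eq_abs]
        have : 1 - s⁻¹ * V x = -(s⁻¹ * (V x - s)) := by field_simp; ring
        rw [this, abs_neg, abs_mul, abs_of_pos (inv_pos.2 hs)]
        calc s⁻¹ * |V x - s| ≤ s⁻¹ * (s * c / (2 * C)) :=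
              mul_le_mul_of_nonneg_left hx' (inv_pos.2 hs).le
          _ = c / (2 * C) := by field_simp
      · simp [indicator_of_notMem hx]
    have h3 : c * ‖g‖ ≤ c / 2 * ‖g‖ := by
      calc c * ‖g‖ ≤ sharpNorm B g := hlow g
        _ ≤ C * ‖g - s⁻¹ • mulOp φ g‖ := h1.trans (hup _)
        _ ≤ C * (c / (2 * C) * ‖g‖) := mul_le_mul_of_nonneg_left h2 hC.le
        _ = c / 2 * ‖g‖ := by field_simp
    have h4 : ‖g‖ = 0 := by
      by_contra hne0
      have : 0 < ‖g‖ := lt_of_le_of_ne (norm_nonneg _) (Ne.symm hne0)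
      nlinarith
    rw [hg, norm_indicatorConstLp (by norm_num) (by norm_num)] at h4
    simpa [measureReal_def, Real.sqrt_eq_zero', Real.rpow_eq_zero_iff_of_nonneg,
      ENNReal.toReal_eq_zero_iff] using h4
  have hneg : V ≤ᵐ[μs] 0 := by
    -- The law of `V` is null near every positive point, hence on `(0, ∞)`, since the real line is
    -- second countable.
    have h1 : (μs.map V) (Ioi 0) = 0 := by
      refine measure_null_of_locally_null _ fun s (hs : 0 < s) => ?_
      refine ⟨Ioo (s - s * c / (2 * C)) (s + s * c / (2 * C)), mem_nhdsWithin_of_mem_nhds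
        (Ioo_mem_nhds ?_ ?_), ?_⟩
      · have : 0 < s * c / (2 * C) := by positivity
        linarith
      · have : 0 < s * c / (2 * C) := by positivity
        linarith
      · rw [Measure.map_apply hV measurableSet_Ioo]
        exact hloc s hs
    rw [Measure.map_apply hV measurableSet_Ioi] at h1
    filter_upwards [measure_eq_zero_iff_ae_notMem.1 h1] with x hx
    simpa using hx
  -- A nonpositive function with mean zero vanishes almost everywhere.
  have h0 : (fun x => -V x) =ᵐ[μs] 0 := by
    refine (integral_eq_zero_iff_of_nonneg_ae ?_ hVi.neg).1 ?_
    · filter_upwards [hneg] with x hx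
      simpa using hx
    · change ∫ x, -V x ∂μs = 0
      rw [integral_neg, hV0, neg_zero]
  filter_upwards [h0] with x hx
  simpa using hx

end Forms

/-! ### Constants, means and the generator. -/

section Generator

variable {𝓧 Ω : Type*} [TopologicalSpace 𝓧] [MeasurableSpace 𝓧] [mΩ : MeasurableSpace Ω]
  {ℱ : Filtration ℝ≥0 mΩ} {X : ℝ≥0 → Ω → 𝓧} {P : Kernel 𝓧 Ω} {μs : Measure 𝓧}

namespace IsMarkovFamily

theorem integrable_comp (hX : IsMarkovFamily ℱ X P) (hinv : IsInvariant X P μs) (t : ℝ≥0)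
    {g : 𝓧 → ℝ} (hg : Integrable g μs) : Integrable (fun ω => g (X t ω)) (lawFrom P μs) := by
  have h : Integrable g ((lawFrom P μs).map (X t)) := by rwa [hinv t]
  exact h.comp_measurable (hX.measurable t)

theorem integral_transition (hX : IsMarkovFamily ℱ X P) (hinv : IsInvariant X P μs) (t : ℝ≥0)
    {g : 𝓧 → ℝ} (hg : Integrable g μs) : ∫ x, transition X P t g x ∂μs = ∫ x, g x ∂μs := by
  rw [← hX.integral_comp_eq hinv t hg.1, integral_lawFrom (hX.integrable_comp hinv t hg)]
  rfl

theorem transition_sub_const (hX : IsMarkovFamily ℱ X P) (hinv : IsInvariant X P μs) (t : ℝ≥0)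
    {g : 𝓧 → ℝ} (hg : Integrable g μs) (a : ℝ) :
    transition X P t (fun x => g x - a) =ᵐ[μs] fun x => transition X P t g x - a := by
  have := hX.isMarkovKernel
  have h := Measure.ae_integrable_of_integrable_comp (hX.integrable_comp hinv t hg)
  filter_upwards [h] with x hx
  simp only [transition]
  rw [integral_sub hx (integrable_const a)]
  simp

variable [IsProbabilityMeasure μs]

theorem generatorGraph_sub_const (hX : IsMarkovFamily ℱ X P) (hinv : IsInvariant X P μs)
    {g Ag : Lp ℝ 2 μs} (h : GeneratorGraph X P μs g Ag) (a : ℝ) :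
    GeneratorGraph X P μs (g - Lp.const 2 μs a) Ag := by
  refine h.congr fun t => eLpNorm_congr_ae ?_
  have hg : Integrable g μs := (Lp.memLp g).integrable (by norm_num)
  have he : (g - Lp.const 2 μs a : Lp ℝ 2 μs) =ᵐ[μs] fun x => g x - a := by
    filter_upwards [Lp.coeFn_sub g (Lp.const 2 μs a), Lp.coeFn_const (p := 2) (μ := μs) a]
      with x h1 h2
    rw [h1, Pi.sub_apply, h2]
    rfl
  filter_upwards [he, hX.transition_congr_ae hinv t he, hX.transition_sub_const hinv t hg a]
    with x h1 h2 h3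
  rw [h2, h3, h1, sub_sub_sub_cancel_right]

/-- Invariance preserves means, so every difference quotient has mean zero; the limit in `L²`
controls the limit of the means. -/
theorem integral_generator_eq_zero (hX : IsMarkovFamily ℱ X P) (hinv : IsInvariant X P μs)
    {g Ag : Lp ℝ 2 μs} (h : GeneratorGraph X P μs g Ag) : ∫ x, Ag x ∂μs = 0 := by
  have := hX.isMarkovKernel
  have hg : Integrable g μs := (Lp.memLp g).integrable (by norm_num)
  have hA : Integrable Ag μs := (Lp.memLp Ag).integrable (by norm_num)
  have hle : ∀ᶠ t : ℝ≥0 in 𝓝[>] 0, ENNReal.ofReal |∫ x, Ag x ∂μs| ≤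
      eLpNorm (fun x => (transition X P t g x - g x) / (t : ℝ) - Ag x) 2 μs := by
    filter_upwards [h.eventually (gt_mem_nhds ENNReal.zero_lt_top), self_mem_nhdsWithin]
      with t ht (ht0 : 0 < t)
    have ht0' : (t : ℝ) ≠ 0 := by exact_mod_cast ht0.ne'
    have hm : Measurable (transition X P t g) :=
      hX.measurable_transition t (Lp.stronglyMeasurable g).measurable
    have hmem : MemLp (fun x => (transition X P t g x - g x) / (t : ℝ) - Ag x) 2 μs :=
      ⟨(((hm.sub (Lp.stronglyMeasurable g).measurable).div_const _).sub
        (Lp.stronglyMeasurable Ag).measurable).aestronglyMeasurable, ht⟩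
    have hi := hmem.integrable (by norm_num)
    have hq : Integrable (fun x => (transition X P t g x - g x) / (t : ℝ)) μs := by
      refine (hi.add hA).congr (Eventually.of_forall fun x => ?_)
      simp
    have ht' : Integrable (transition X P t g) μs := by
      refine ((hq.mul_const (t : ℝ)).add hg).congr (Eventually.of_forall fun x => ?_)
      simp only [Pi.add_apply]
      field_simp; ring
    have hval : ∫ x, ((transition X P t g x - g x) / (t : ℝ) - Ag x) ∂μs = -∫ x, Ag x ∂μs := by
      rw [integral_sub hq hA, integral_div, integral_sub ht' hg, hX.integral_transition hinv t hg]
      simp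
    rw [← abs_neg, ← hval]
    calc ENNReal.ofReal |∫ x, ((transition X P t g x - g x) / (t : ℝ) - Ag x) ∂μs|
        ≤ eLpNorm (fun x => (transition X P t g x - g x) / (t : ℝ) - Ag x) 1 μs := by
          rw [← Real.norm_eq_abs, ofReal_norm, eLpNorm_one_eq_lintegral_enorm]
          exact enorm_integral_le_lintegral_enorm _
      _ ≤ _ := eLpNorm_le_eLpNorm_of_exponent_le (by norm_num) hmem.1
  have h0 : ENNReal.ofReal |∫ x, Ag x ∂μs| ≤ 0 := ge_of_tendsto h hle
  have : |∫ x, Ag x ∂μs| ≤ 0 := ENNReal.ofReal_eq_zero.1 (le_antisymm h0 zero_le)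
  exact abs_eq_zero.1 (le_antisymm this (abs_nonneg _))

end IsMarkovFamily

end Generator

/-! ### Optimising the exponential bound. -/

section Chernoff

/-- Optimisation of a sub-gamma Chernoff bound. -/
theorem le_mul_exp_of_subgamma {p N T v b η : ℝ} (hv : 0 ≤ v) (hb : 0 < b) (hη : 0 ≤ η)
    (h : ∀ lam : ℝ, 0 ≤ lam → lam * b < 1 → p ≤ N * Real.exp (T * (lam ^ 2 * v /
      (2 * (1 - lam * b)) - lam * (√(2 * v * η) + b * η)))) :
    p ≤ N * Real.exp (-(T * η)) := by
  -- When `v = 0` the optimal `lam = 1 / b` is excluded from the hypothesis, so the bound is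
  -- obtained as a limit from the left. This case is where `b > 0` is essential.
  rcases hv.eq_or_lt with rfl | hv
  · have hlim : Tendsto (fun lam : ℝ => N * Real.exp (T * (-(lam * (b * η))))) (𝓝[<] (1 / b))
        (𝓝 (N * Real.exp (T * (-(1 / b * (b * η)))))) := by
      refine Tendsto.mono_left (Continuous.tendsto ?_ _) nhdsWithin_le_nhds
      fun_prop
    have e : T * (-(1 / b * (b * η))) = -(T * η) := by field_simp
    rw [e] at hlim
    refine ge_of_tendsto hlim ?_
    filter_upwards [Ioo_mem_nhdsLT (one_div_pos.2 hb)] with lam hl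
    have h1 := h lam hl.1.le ((lt_div_iff₀ hb).1 hl.2)
    simpa using h1
  -- The choice `lam = q / (1 + b q)` makes the exponent exactly `-η`, using `√(2 v η) = v q` and `η
  -- = v q² / 2`.
  · set q := √(2 * η / v) with hq
    have hq0 : 0 ≤ q := Real.sqrt_nonneg _
    have hqq : q ^ 2 = 2 * η / v := Real.sq_sqrt (by positivity)
    have hvq : √(2 * v * η) = v * q := by
      rw [Real.sqrt_eq_iff_mul_self_eq (by positivity) (by positivity)]
      have : v * q * (v * q) = v ^ 2 * q ^ 2 := by ring
      rw [this, hqq]; field_simp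
    have hη2 : η = v * q ^ 2 / 2 := by rw [hqq]; field_simp
    have hden : 0 < 1 + b * q := by positivity
    have h1b : 1 - q / (1 + b * q) * b = 1 / (1 + b * q) := by field_simp; ring
    have hlt : q / (1 + b * q) * b < 1 := by
      have : 0 < 1 / (1 + b * q) := by positivity
      linarith
    have h1 := h (q / (1 + b * q)) (by positivity) hlt
    have e : (q / (1 + b * q)) ^ 2 * v / (2 * (1 - q / (1 + b * q) * b)) -
        q / (1 + b * q) * (√(2 * v * η) + b * η) = -η := by
      rw [h1b, hvq, hη2]
      field_simp; ring
    rwa [e, mul_neg] at h1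

end Chernoff

/-! ### Exponential moments and one-sided deviations. -/

section Concentration

variable {𝓧 Ω : Type*} [TopologicalSpace 𝓧] [PolishSpace 𝓧] [MeasurableSpace 𝓧] [BorelSpace 𝓧]
  [mΩ : MeasurableSpace Ω] {ℱ : Filtration ℝ≥0 mΩ} {X : ℝ≥0 → Ω → 𝓧} {P : Kernel 𝓧 Ω}
  {μs : Measure 𝓧} [IsProbabilityMeasure μs] {V : 𝓧 → ℝ} {K : ℝ}
  {B : LinearMap.BilinForm ℝ (Lp ℝ 2 μs)} {c C α : ℝ} {φ : Lp ℝ ∞ μs}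

/-- The growth bound of the Feynman-Kac semigroup in the modified norm. -/
theorem sharpNorm_feynmanKacLp_le (hX : IsMarkovFamily ℱ X P) (hinv : IsInvariant X P μs)
    (hB : IsInnerProduct B) (hc : 0 < c) (hcC : c ≤ C)
    (hlow : ∀ g, c * ‖g‖ ≤ sharpNorm B g) (hup : ∀ g, sharpNorm B g ≤ C * ‖g‖)
    (hone : ∀ g, B g (Lp.const 2 μs (1 : ℝ)) = inner ℝ g (Lp.const 2 μs (1 : ℝ)))
    (hα : 0 < α)
    (hpoincare : ∀ g Ag : Lp ℝ 2 μs, GeneratorGraph X P μs g Ag → ∫ x, g x ∂μs = 0 →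
      sharpNorm B g ^ 2 ≤ α * B (-Ag) g)
    (hV : Measurable V) (hφ : φ =ᵐ[μs] V) (hV0 : ∫ x, V x ∂μs = 0)
    {lam : ℝ} (hlam : 0 ≤ lam) (hlb : lam * bConst B α φ < 1)
    (hK : ∀ x, |lam * V x| ≤ K) {T : ℝ} (hT : 0 ≤ T) :
    sharpNorm B (hX.feynmanKacLp hinv (hV.const_mul lam) hK T) ≤
      Real.exp (T * (lam ^ 2 * vConst B α φ / (2 * (1 - lam * bConst B α φ)))) := by
  have := hX.isMarkovKernel
  have hW := hV.const_mul lam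
  set U := hX.feynmanKacLp hinv hW hK with hU
  set Λ := lam ^ 2 * vConst B α φ / (2 * (1 - lam * bConst B α φ)) with hΛ
  obtain ⟨Bc, hBc⟩ := hB.exists_continuousLinearMap hup
  have hdiss : ∀ t ∈ Ico 0 T, Bc (hX.feynmanKacDerivLp hinv hW hK t) (U t) ≤
      Λ * Bc (U t) (U t) := fun t ht => by
    have hgraph : GeneratorGraph X P μs (U t) (hX.feynmanKacDerivLp hinv hW hK t
        - lam • mulOp φ (U t)) := by
      refine hX.generatorGraph_feynmanKacLp hinv hW hK ht.1 ?_
      filter_upwards [Lp.coeFn_smul lam (mulOp φ (U t)), coeFn_mulOp hφ (U t),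
        coeFn_boundedLp (μ := μs) (hX.measurable_feynmanKac hinv hW hK t)
          (hX.abs_feynmanKac_le hinv hW hK t)] with x h1 h2 h3
      rw [h1, Pi.smul_apply, h2, smul_eq_mul, mul_assoc]
      simp only [hU, IsMarkovFamily.feynmanKacLp]
      rw [h3]
    have hmean : ∫ x, (U t - Lp.const 2 μs (∫ y, U t y ∂μs) : Lp ℝ 2 μs) x ∂μs = 0 := by
      have hi : Integrable (U t) μs := (Lp.memLp (U t)).integrable (by norm_num)
      rw [integral_congr_ae (g := fun x => U t x - ∫ y, U t y ∂μs), integral_sub hi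
        (integrable_const _)]
      · simp
      · filter_upwards [Lp.coeFn_sub (U t) (Lp.const 2 μs (∫ y, U t y ∂μs)),
          Lp.coeFn_const (p := 2) (μ := μs) (∫ y, U t y ∂μs)] with x h1 h2
        rw [h1, Pi.sub_apply, h2]
        rfl
    -- The Poincaré inequality is available only for mean-zero elements of the domain. Subtracting
    -- the mean stays in the domain and leaves the image under the generator unchanged.
    have h1 := form_generator_add_mulOp_le hB hc hcC hlow hup hone hα hφ hV0 hlam hlb
      (hX.integral_generator_eq_zero hinv hgraph)
      (hpoincare _ _ (hX.generatorGraph_sub_const hinv hgraph _) hmean)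
    rw [sub_add_cancel] at h1
    rw [hBc, hBc]
    exact h1
  have h := bilin_self_le_exp Bc (fun g h => by rw [hBc, hBc, hB.symm]) hT
    (hX.continuousOn_feynmanKacLp hinv hW hK T)
    (fun t _ => hX.hasDerivWithinAt_feynmanKacLp hinv hW hK t) hdiss
  have hU0 : U 0 = Lp.const 2 μs (1 : ℝ) := by
    refine Lp.ext ?_
    filter_upwards [coeFn_boundedLp (μ := μs) (hX.measurable_feynmanKac hinv hW hK 0)
      (hX.abs_feynmanKac_le hinv hW hK 0), Lp.coeFn_const (p := 2) (μ := μs) (1 : ℝ)] with x h1 h2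
    simp only [hU, IsMarkovFamily.feynmanKacLp]
    rw [h1, h2]
    simp [feynmanKac]
  have hB0 : Bc (U 0) (U 0) = 1 := by
    rw [hBc, hU0, hone, inner_const_one,
      integral_congr_ae (Lp.coeFn_const (p := 2) (μ := μs) (1 : ℝ))]
    simp
  rw [← hU, hB0, one_mul, hBc] at h
  rw [sharpNorm, Real.sqrt_le_left (Real.exp_pos _).le, sq, ← Real.exp_add]
  refine h.trans (le_of_eq ?_)
  congr 1
  ring

/-- Exponential moments of the additive functional started from `μ`. -/
theorem integral_exp_le (hX : IsMarkovFamily ℱ X P) (hinv : IsInvariant X P μs)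
    (hB : IsInnerProduct B) (hc : 0 < c) (hcC : c ≤ C)
    (hlow : ∀ g, c * ‖g‖ ≤ sharpNorm B g) (hup : ∀ g, sharpNorm B g ≤ C * ‖g‖)
    (hone : ∀ g, B g (Lp.const 2 μs (1 : ℝ)) = inner ℝ g (Lp.const 2 μs (1 : ℝ)))
    (hα : 0 < α)
    (hpoincare : ∀ g Ag : Lp ℝ 2 μs, GeneratorGraph X P μs g Ag → ∫ x, g x ∂μs = 0 →
      sharpNorm B g ^ 2 ≤ α * B (-Ag) g)
    {μ : Measure 𝓧} [IsProbabilityMeasure μ] (hμ : μ ≪ μs)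
    (hμ2 : eLpNorm (fun x => (μ.rnDeriv μs x).toReal) 2 μs ≠ ∞)
    (hV : Measurable V) (hK : ∀ x, |V x| ≤ K) (hφ : φ =ᵐ[μs] V) (hV0 : ∫ x, V x ∂μs = 0)
    {lam : ℝ} (hlam : 0 ≤ lam) (hlb : lam * bConst B α φ < 1) {T : ℝ} (hT : 0 ≤ T) :
    ∫ ω, Real.exp (lam * ∫ s in 0..T, V (X s.toNNReal ω)) ∂(lawFrom P μ) ≤
      c⁻¹ * densityNorm μ μs *
        Real.exp (T * (lam ^ 2 * vConst B α φ / (2 * (1 - lam * bConst B α φ)))) := by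
  have := hX.isMarkovKernel
  have hW := hV.const_mul lam
  have hWK : ∀ x, |lam * V x| ≤ lam * K := fun x => by
    rw [abs_mul, abs_of_nonneg hlam]
    exact mul_le_mul_of_nonneg_left (hK x) hlam
  have hmem : MemLp (fun x => (μ.rnDeriv μs x).toReal) 2 μs :=
    ⟨(Measure.measurable_rnDeriv μ μs).ennreal_toReal.aestronglyMeasurable, hμ2.lt_top⟩
  set U := hX.feynmanKacLp hinv hW hWK T with hU
  have hnU : c * ‖U‖ ≤ Real.exp (T * (lam ^ 2 * vConst B α φ / (2 * (1 - lam * bConst B α φ)))) :=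
    (hlow U).trans (sharpNorm_feynmanKacLp_le hX hinv hB hc hcC hlow hup hone hα hpoincare hV hφ
      hV0 hlam hlb hWK hT)
  have hnD : ‖hmem.toLp‖ = densityNorm μ μs := Lp.norm_toLp _ hmem
  have e : ∫ ω, Real.exp (lam * ∫ s in 0..T, V (X s.toNNReal ω)) ∂(lawFrom P μ) =
      inner ℝ hmem.toLp U := by
    simp_rw [← intervalIntegral.integral_const_mul]
    rw [integral_lawFrom (integrable_of_abs_le (hX.measurable_exp_integral hinv hW hWK 0 T)
      (hX.abs_exp_integral_le hinv hW hWK 0 T)), ← integral_rnDeriv_smul hμ, L2.inner_def]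
    refine integral_congr_ae ?_
    filter_upwards [hmem.coeFn_toLp, coeFn_boundedLp (μ := μs)
      (hX.measurable_feynmanKac hinv hW hWK T) (hX.abs_feynmanKac_le hinv hW hWK T)] with x h1 h2
    rw [h1]
    simp only [hU, IsMarkovFamily.feynmanKacLp]
    rw [h2, feynmanKac, smul_eq_mul]
    simp [mul_comm]
  rw [e]
  calc inner ℝ hmem.toLp U ≤ ‖hmem.toLp‖ * ‖U‖ := real_inner_le_norm _ _
    _ = c⁻¹ * densityNorm μ μs * (c * ‖U‖) := by rw [hnD]; field_simp
    _ ≤ _ := by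
      refine mul_le_mul_of_nonneg_left hnU (mul_nonneg (inv_pos.2 hc).le ENNReal.toReal_nonneg)

/-- One-sided Bernstein inequality for additive functionals. -/
theorem measureReal_radius_le (hX : IsMarkovFamily ℱ X P) (hinv : IsInvariant X P μs)
    (hB : IsInnerProduct B) (hc : 0 < c) (hcC : c ≤ C)
    (hlow : ∀ g, c * ‖g‖ ≤ sharpNorm B g) (hup : ∀ g, sharpNorm B g ≤ C * ‖g‖)
    (hone : ∀ g, B g (Lp.const 2 μs (1 : ℝ)) = inner ℝ g (Lp.const 2 μs (1 : ℝ)))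
    (hα : 0 < α)
    (hpoincare : ∀ g Ag : Lp ℝ 2 μs, GeneratorGraph X P μs g Ag → ∫ x, g x ∂μs = 0 →
      sharpNorm B g ^ 2 ≤ α * B (-Ag) g)
    {μ : Measure 𝓧} [IsProbabilityMeasure μ] (hμ : μ ≪ μs)
    (hμ2 : eLpNorm (fun x => (μ.rnDeriv μs x).toReal) 2 μs ≠ ∞)
    (hV : Measurable V) (hK : ∀ x, |V x| ≤ K) (hφ : φ =ᵐ[μs] V) (hV0 : ∫ x, V x ∂μs = 0)
    (hne : ¬ V =ᵐ[μs] 0) {T : ℝ} (hT : 0 < T) {δ : ℝ} (hδ0 : 0 < δ) (hδ1 : δ < 1) :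
    (lawFrom P μ).real {ω | radius (vConst B α φ) (bConst B α φ) (c⁻¹ * densityNorm μ μs) δ T ≤
      (1 / T) * ∫ s in 0..T, V (X s.toNNReal ω)} ≤ δ / 2 := by
  have := hX.isMarkovKernel
  set N := c⁻¹ * densityNorm μ μs with hN
  set v := vConst B α φ with hvd
  set b := bConst B α φ with hbd
  have hexp := fun (lam : ℝ) (hlam : 0 ≤ lam) (hlb : lam * b < 1) =>
    integral_exp_le hX hinv hB hc hcC hlow hup hone hα hpoincare hμ hμ2 hV hK hφ hV0 hlam hlb hT.le
  -- The moment bound at `lam = 0` reads `1 ≤ N`, which makes `log(2 N / δ)` nonnegative.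
  have hN1 : 1 ≤ N := by simpa using hexp 0 le_rfl (by simp)
  have hv : 0 ≤ v := by
    have := hα.le
    rw [hvd, vConst]; positivity
  have hb : 0 < b := bConst_pos hB hc hcC hlow hup hα hφ hV (integrable_of_abs_le hV hK) hV0 hne
  set η := (1 / T) * Real.log (2 * N / δ) with hη
  have hη0 : 0 ≤ η := mul_nonneg (by positivity) (Real.log_nonneg (by
    rw [le_div_iff₀ hδ0]; linarith))
  have hr : radius v b N δ T = √(2 * v * η) + b * η := by
    rw [radius, hη]; ring_nf
  have hend : N * Real.exp (-(T * η)) = δ / 2 := by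
    have hTη : T * η = Real.log (2 * N / δ) := by rw [hη]; field_simp
    rw [hTη, Real.exp_neg, Real.exp_log (by positivity)]
    field_simp
  rw [← hend, hr]
  refine le_mul_exp_of_subgamma hv hb hη0 fun lam hlam hlb => ?_
  have hv' := hX.isL1RightCts hinv hV hK
  have hset : {ω | √(2 * v * η) + b * η ≤ (1 / T) * ∫ s in 0..T, V (X s.toNNReal ω)} =
      {ω | T * (√(2 * v * η) + b * η) ≤ ∫ s in 0..T, V (X s.toNNReal ω)} := by
    ext ω
    simp only [mem_ofPred_eq]
    rw [one_div, inv_mul_eq_div, le_div_iff₀ hT, mul_comm]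
  have hint : Integrable (fun ω => Real.exp (lam * ∫ s in 0..T, V (X s.toNNReal ω)))
      (lawFrom P μ) := by
    refine integrable_of_abs_le (K := Real.exp (lam * (K * |T - 0|)))
      ((hv'.measurable_intervalIntegral 0 T).const_mul lam).exp fun ω => abs_exp_le ?_
    rw [abs_mul, abs_of_nonneg hlam]
    exact mul_le_mul_of_nonneg_left (hv'.abs_intervalIntegral_le ω 0 T) hlam
  have hch := measure_ge_le_exp_mul_mgf (μ := lawFrom P μ)
    (X := fun ω => ∫ s in 0..T, V (X s.toNNReal ω)) (T * (√(2 * v * η) + b * η)) hlam hint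
  rw [hset]
  refine hch.trans ?_
  calc _ ≤ Real.exp (-lam * (T * (√(2 * v * η) + b * η))) *
        (N * Real.exp (T * (lam ^ 2 * v / (2 * (1 - lam * b))))) :=
        mul_le_mul_of_nonneg_left (hexp lam hlam hlb) (Real.exp_pos _).le
    _ = _ := by
      rw [mul_left_comm, ← Real.exp_add]
      ring_nf

end Concentration

end ErgodicConfidence

/-! ### The two-sided confidence interval. -/

open ErgodicConfidence
theorem corollary3p3
    {𝓧 Ω : Type*} [TopologicalSpace 𝓧] [PolishSpace 𝓧] [MeasurableSpace 𝓧] [BorelSpace 𝓧]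
    [mΩ : MeasurableSpace Ω]
    (ℱ : Filtration ℝ≥0 mΩ) (X : ℝ≥0 → Ω → 𝓧) (P : Kernel 𝓧 Ω)
    (hX : IsMarkovFamily ℱ X P)
    -- the invariant ergodic probability measure
    (μs : Measure 𝓧) [IsProbabilityMeasure μs]
    (hinv : IsInvariant X P μs) (herg : IsErgodic X P μs)
    -- the modified inner product on `L²(μs)`
    (B : LinearMap.BilinForm ℝ (Lp ℝ 2 μs)) (hB : IsInnerProduct B)
    (c C : ℝ) (hc : 0 < c) (hcC : c ≤ C)
    (hlow : ∀ g, c * ‖g‖ ≤ sharpNorm B g) (hup : ∀ g, sharpNorm B g ≤ C * ‖g‖)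
    (hone : ∀ g, B g (Lp.const 2 μs (1 : ℝ)) = inner ℝ g (Lp.const 2 μs (1 : ℝ)))
    -- the Poincaré inequality
    (α : ℝ) (hα : 0 < α)
    (hpoincare : ∀ g Ag : Lp ℝ 2 μs, GeneratorGraph X P μs g Ag → ∫ x, g x ∂μs = 0 →
      sharpNorm B g ^ 2 ≤ α * B (-Ag) g)
    -- the initial distribution, with a square integrable density
    (μ : Measure 𝓧) [IsProbabilityMeasure μ] (hμ : μ ≪ μs)
    (hμ2 : eLpNorm (fun x => (μ.rnDeriv μs x).toReal) 2 μs ≠ ∞)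
    -- the bounded observable, which is not almost everywhere constant
    (f : 𝓧 → ℝ) (hf : Measurable f) (hb : ∃ K, ∀ x, |f x| ≤ K)
    (hconst : ¬ ∃ a : ℝ, f =ᵐ[μs] fun _ => a)
    (T : ℝ) (hT : 0 < T) (δ : ℝ) (hδ0 : 0 < δ) (hδ1 : δ < 1) :
    1 - δ ≤ (lawFrom P μ).real
      {ω | ergodicAverage X f T ω - ∫ x, f x ∂μs ∈ Ioo
        (-radius (vConst B α (-centered μs hf hb)) (bConst B α (-centered μs hf hb))
          (c⁻¹ * densityNorm μ μs) δ T)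
        (radius (vConst B α (centered μs hf hb)) (bConst B α (centered μs hf hb))
          (c⁻¹ * densityNorm μ μs) δ T)} := by
  have := hX.isMarkovKernel
  obtain ⟨K, hK⟩ := hb
  set m := ∫ x, f x ∂μs with hm
  have hKV : ∀ x, |f x - m| ≤ K + |m| := fun x => (abs_sub _ _).trans (by linarith [hK x])
  have hKV' : ∀ x, |-(f x - m)| ≤ K + |m| := fun x => by rw [abs_neg]; exact hKV x
  have hVm : Measurable fun x => f x - m := hf.sub_const m
  have hfi : Integrable f μs := integrable_of_abs_le hf hK
  have hV0 : ∫ x, (f x - m) ∂μs = 0 := by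
    rw [integral_sub hfi (integrable_const m)]
    simp [hm]
  have hne : ¬ (fun x => f x - m) =ᵐ[μs] 0 := fun h =>
    hconst ⟨m, h.mono fun x hx => sub_eq_zero.1 hx⟩
  have hφ : centered μs hf ⟨K, hK⟩ =ᵐ[μs] fun x => f x - m := MemLp.coeFn_toLp _
  have hφ' : (-centered μs hf ⟨K, hK⟩ : Lp ℝ ∞ μs) =ᵐ[μs] fun x => -(f x - m) := by
    filter_upwards [Lp.coeFn_neg (centered μs hf ⟨K, hK⟩), hφ] with x h1 h2
    rw [h1, Pi.neg_apply, h2]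
  have hpos := measureReal_radius_le hX hinv hB hc hcC hlow hup hone hα hpoincare hμ hμ2 hVm hKV
    hφ hV0 hne hT hδ0 hδ1
  have hneg := measureReal_radius_le hX hinv hB hc hcC hlow hup hone hα hpoincare hμ hμ2 hVm.neg
    hKV' hφ' ((integral_neg _).trans (by rw [hV0, neg_zero]))
    (fun h => hne (h.mono fun x hx => neg_eq_zero.1 hx)) hT hδ0 hδ1
  have hcts := hX.isL1RightCts hinv hf hK
  have hsub : ∀ ω, (1 / T) * ∫ s in 0..T, (f (X s.toNNReal ω) - m) =
      ergodicAverage X f T ω - m := fun ω => by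
    rw [intervalIntegral.integral_sub (hcts.intervalIntegrable ω 0 T) intervalIntegrable_const,
      intervalIntegral.integral_const, ergodicAverage, smul_eq_mul]
    field_simp
    ring
  have hsub' : ∀ ω, (1 / T) * ∫ s in 0..T, -(f (X s.toNNReal ω) - m) =
      -(ergodicAverage X f T ω - m) := fun ω => by
    rw [intervalIntegral.integral_neg, mul_neg, hsub]
  simp only [hsub] at hpos
  simp only [Pi.neg_apply, hsub'] at hneg
  set r₁ := radius (vConst B α (centered μs hf ⟨K, hK⟩)) (bConst B α (centered μs hf ⟨K, hK⟩))
    (c⁻¹ * densityNorm μ μs) δ T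
  set r₂ := radius (vConst B α (-centered μs hf ⟨K, hK⟩)) (bConst B α (-centered μs hf ⟨K, hK⟩))
    (c⁻¹ * densityNorm μ μs) δ T
  have hmeas : Measurable fun ω => ergodicAverage X f T ω - m :=
    ((hcts.measurable_intervalIntegral 0 T).const_mul (1 / T)).sub_const m
  have hgood : MeasurableSet {ω | ergodicAverage X f T ω - m ∈ Ioo (-r₂) r₁} :=
    hmeas measurableSet_Ioo
  -- Leaving the open interval means that the deviation of `f` reaches `r₁` or that of `-f` reaches
  -- `r₂`; each event has probability at most `δ / 2`.
  have hbad : (lawFrom P μ).real {ω | ergodicAverage X f T ω - m ∈ Ioo (-r₂) r₁}ᶜ ≤ δ := by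
    have hcover : {ω | ergodicAverage X f T ω - m ∈ Ioo (-r₂) r₁}ᶜ ⊆
        {ω | r₁ ≤ ergodicAverage X f T ω - m} ∪ {ω | r₂ ≤ -(ergodicAverage X f T ω - m)} := by
      intro ω hω
      simp only [mem_compl_iff, mem_ofPred_eq, mem_Ioo, not_and_or, not_lt, mem_union] at hω ⊢
      rcases hω with h | h
      · exact Or.inr (by linarith)
      · exact Or.inl h
    exact (measureReal_mono hcover).trans ((measureReal_union_le _ _).trans (by linarith))
  rw [probReal_compl_eq_one_sub hgood] at hbad
  linarith
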